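/- For $\alpha>0$ let $L^\alpha$ be the modified fractional Volterra operator on the complex Hilbert space $L_2([0,1])$, $$ L^\alpha f(x)=\frac1{\Gamma(\alpha)}\int_0^x (x-y)^{\alpha-1}e^{y-x}f(y)\,dy . $$ Then $\alpha\mapsto L^\alpha$ is Bochner integrable on $(0,1/2)$ with respect to the operator norm, and the operators $$ A=-\int_0^{1/2}L^\alpha\,d\alpha ,\qquad T=e^A $$ on $L_2([0,1])$ have the following properties. 1. $A\ne0$, $\sigma(A)=\{0\}$, and $\limsup_{t\to\infty} t\,\|Ae^{tA}\|\le 1/e$. 2. $T\ne I$, $\sigma(T)=\{1\}$, and $\limsup_{n\to\infty} n\,\|T^{n+1}-T^n\|\le 1/e$. Consequently the constant $1/e$ cannot be enlarged in Esterle-type theorems: for every real $C>1/e$, neither of the following assertions holds for all bounded operators on all complex Hilbert spaces: (a) if $\sigma(A)=\{0\}$ and $\liminf_{t\to\infty}t\|Ae^{tA}\|<C$, then $A=0$; (b) if $\sigma(T)=\{1\}$ and $\liminf_{n\to\infty}n\|T^{n+1}-T^n\|<C$, then $T=I$. -/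

import Mathlib

open MeasureTheory Filter Topology
open scoped ENNReal

noncomputable section

namespace ModVolterra

/-- Lebesgue measure on `[0,1]`. -/
abbrev unitMeasure : Measure ℝ := volume.restrict (Set.Icc (0 : ℝ) 1)

/-- The complex Hilbert space `L²([0,1])`. -/
abbrev L2 : Type := Lp ℂ 2 unitMeasure

/-- `(L^α f)(x) = Γ(α)⁻¹ ∫_0^x (x-y)^(α-1) e^(y-x) f(y) dy`, as a function of `x`. -/
def fracFun (α : ℝ) (f : ℝ → ℂ) (x : ℝ) : ℂ :=
  (((Real.Gamma α)⁻¹ : ℝ) : ℂ) *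
    ∫ y in (0 : ℝ)..x, (((x - y) ^ (α - 1) * Real.exp (y - x) : ℝ) : ℂ) * f y

/-- The convolution kernel of `L^α`. -/
def ker (α : ℝ) (s : ℝ) : ℝ :=
  if 0 < s then (Real.Gamma α)⁻¹ * (s ^ (α - 1) * Real.exp (-s)) else 0

theorem measurable_ker (α : ℝ) : Measurable (ker α) := by
  unfold ker
  refine Measurable.ite measurableSet_Ioi ?_ measurable_const
  fun_prop

theorem integrable_ker {α : ℝ} (hα : 0 < α) : Integrable (ker α) := by
  have h := (Real.GammaIntegral_convergent hα).const_mul (Real.Gamma α)⁻¹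
  rw [← IntegrableOn, ← integrable_indicator_iff measurableSet_Ioi] at h
  refine h.congr (Eventually.of_forall fun s => ?_)
  by_cases hs : 0 < s
  · simp [ker, hs, Set.indicator, mul_comm]
  · simp [ker, hs, Set.indicator]

theorem fracFun_eq (α : ℝ) (f : ℝ → ℂ) {x : ℝ} (hx : x ∈ Set.Icc (0 : ℝ) 1) :
    fracFun α f x = ∫ y, ((ker α (x - y) : ℝ) : ℂ) * f y ∂unitMeasure := by
  unfold fracFun
  rw [intervalIntegral.integral_of_le hx.1, integral_Ioc_eq_integral_Ioo,
    ← integral_const_mul, ← integral_indicator measurableSet_Ioo, unitMeasure,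
    integral_Icc_eq_integral_Ioc, integral_Ioc_eq_integral_Ioo,
    ← integral_indicator measurableSet_Ioo]
  congr 1
  ext y
  by_cases h0 : 0 < y
  · by_cases h1 : y < x
    · have h2 : y < 1 := h1.trans_le hx.2
      simp [Set.indicator, h0, h1, h2, ker, mul_assoc]
    · simp [Set.indicator, h1, ker]
  · simp [Set.indicator, h0]

theorem enorm_ofReal_eq (r : ℝ) : ‖(r : ℂ)‖ₑ = ‖r‖ₑ := by
  rw [← ofReal_norm, ← ofReal_norm, Complex.norm_real]

/-- Schur test for a convolution kernel. -/
theorem schur {k : ℝ → ℝ} (hk : Measurable k) {f : ℝ → ℂ}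
    (hf : AEStronglyMeasurable f unitMeasure) :
    ∫⁻ x, (∫⁻ y, ‖k (x - y)‖ₑ * ‖f y‖ₑ ∂unitMeasure) ^ (2 : ℝ) ∂unitMeasure
      ≤ (∫⁻ s, ‖k s‖ₑ) ^ (2 : ℝ) * ∫⁻ y, ‖f y‖ₑ ^ (2 : ℝ) ∂unitMeasure := by
  have hfe : AEMeasurable (fun y => ‖f y‖ₑ) unitMeasure := hf.enorm
  have hmass : ∀ x, ∫⁻ y, ‖k (x - y)‖ₑ ∂unitMeasure ≤ ∫⁻ s, ‖k s‖ₑ := fun x =>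
    (lintegral_mono' Measure.restrict_le_self le_rfl).trans
      (lintegral_sub_left_eq_self (fun s => ‖k s‖ₑ) x).le
  have hmass' : ∀ y, ∫⁻ x, ‖k (x - y)‖ₑ ∂unitMeasure ≤ ∫⁻ s, ‖k s‖ₑ := fun y =>
    (lintegral_mono' Measure.restrict_le_self le_rfl).trans
      (lintegral_sub_right_eq_self (fun s => ‖k s‖ₑ) y).le
  have hpt : ∀ x, (∫⁻ y, ‖k (x - y)‖ₑ * ‖f y‖ₑ ∂unitMeasure) ^ (2 : ℝ)
      ≤ (∫⁻ s, ‖k s‖ₑ) * ∫⁻ y, ‖k (x - y)‖ₑ * ‖f y‖ₑ ^ (2 : ℝ) ∂unitMeasure := by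
    intro x
    have hkx : AEMeasurable (fun y => ‖k (x - y)‖ₑ) unitMeasure := by fun_prop
    have h2 : ∀ a : ℝ≥0∞, (a ^ (1 / 2 : ℝ)) ^ (2 : ℝ) = a := fun a => by
      rw [← ENNReal.rpow_mul]; norm_num
    have hsplit : ∀ a : ℝ≥0∞, a ^ (1 / 2 : ℝ) * a ^ (1 / 2 : ℝ) = a := fun a => by
      rw [← ENNReal.rpow_add_of_nonneg _ _ (by norm_num) (by norm_num)]; norm_num
    have hH := ENNReal.lintegral_mul_le_Lp_mul_Lq unitMeasure Real.HolderConjugate.two_two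
      (f := fun y => ‖k (x - y)‖ₑ ^ (1 / 2 : ℝ))
      (g := fun y => ‖k (x - y)‖ₑ ^ (1 / 2 : ℝ) * ‖f y‖ₑ)
      (hkx.pow_const _) ((hkx.pow_const _).mul hfe)
    simp only [Pi.mul_apply, ← mul_assoc, hsplit, h2,
      ENNReal.mul_rpow_of_nonneg _ _ (zero_le_two (α := ℝ))] at hH
    calc _ ≤ _ := ENNReal.rpow_le_rpow hH zero_le_two
      _ = (∫⁻ y, ‖k (x - y)‖ₑ ∂unitMeasure) *
          ∫⁻ y, ‖k (x - y)‖ₑ * ‖f y‖ₑ ^ (2 : ℝ) ∂unitMeasure := by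
        rw [ENNReal.mul_rpow_of_nonneg _ _ zero_le_two, h2, h2]
      _ ≤ _ := mul_le_mul_left (hmass x) _
  have hmeas : AEMeasurable (Function.uncurry fun x y => ‖k (x - y)‖ₑ * ‖f y‖ₑ ^ (2 : ℝ))
      (unitMeasure.prod unitMeasure) := by
    refine AEMeasurable.mul ?_ ?_
    · exact (hk.comp (measurable_fst.sub measurable_snd)).enorm.aemeasurable
    · exact (hfe.pow_const _).comp_snd
  calc _ ≤ ∫⁻ x, (∫⁻ s, ‖k s‖ₑ) *
        ∫⁻ y, ‖k (x - y)‖ₑ * ‖f y‖ₑ ^ (2 : ℝ) ∂unitMeasure ∂unitMeasure := lintegral_mono hpt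
    _ = (∫⁻ s, ‖k s‖ₑ) *
        ∫⁻ x, ∫⁻ y, ‖k (x - y)‖ₑ * ‖f y‖ₑ ^ (2 : ℝ) ∂unitMeasure ∂unitMeasure :=
      lintegral_const_mul'' _ hmeas.lintegral_prod_right'
    _ = (∫⁻ s, ‖k s‖ₑ) *
        ∫⁻ y, (∫⁻ x, ‖k (x - y)‖ₑ ∂unitMeasure) * ‖f y‖ₑ ^ (2 : ℝ) ∂unitMeasure := by
      rw [lintegral_lintegral_swap hmeas]
      congr 1
      refine lintegral_congr fun y => ?_
      exact lintegral_mul_const _ (by fun_prop)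
    _ ≤ (∫⁻ s, ‖k s‖ₑ) * ∫⁻ y, (∫⁻ s, ‖k s‖ₑ) * ‖f y‖ₑ ^ (2 : ℝ) ∂unitMeasure := by
      refine mul_le_mul_right (lintegral_mono fun y => ?_) _
      exact mul_le_mul_left (hmass' y) _
    _ = _ := by
      rw [lintegral_const_mul'' _ (hfe.pow_const _), ← mul_assoc, ENNReal.rpow_two, sq]

theorem ae_integrable {α : ℝ} (hα : 0 < α) {f : ℝ → ℂ} (hf : MemLp f 2 unitMeasure) :
    ∀ᵐ x ∂unitMeasure, Integrable (fun y => ((ker α (x - y) : ℝ) : ℂ) * f y) unitMeasure := by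
  have hS := schur (measurable_ker α) hf.1
  have hfin : (∫⁻ s, ‖ker α s‖ₑ) ^ (2 : ℝ) * ∫⁻ y, ‖f y‖ₑ ^ (2 : ℝ) ∂unitMeasure < ∞ := by
    refine ENNReal.mul_lt_top (ENNReal.rpow_lt_top_of_nonneg zero_le_two
      (integrable_ker hα).2.ne) ?_
    simpa using lintegral_rpow_enorm_lt_top_of_eLpNorm_lt_top two_ne_zero ENNReal.ofNat_ne_top hf.2
  have hm : AEMeasurable (fun x => (∫⁻ y, ‖ker α (x - y)‖ₑ * ‖f y‖ₑ ∂unitMeasure) ^ (2 : ℝ))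
      unitMeasure := by
    refine AEMeasurable.pow_const ?_ _
    have : AEMeasurable (Function.uncurry fun x y => ‖ker α (x - y)‖ₑ * ‖f y‖ₑ)
        (unitMeasure.prod unitMeasure) :=
      ((measurable_ker α).comp (measurable_fst.sub measurable_snd)).enorm.aemeasurable.mul
        hf.1.enorm.comp_snd
    exact this.lintegral_prod_right'
  filter_upwards [ae_lt_top' hm (hS.trans_lt hfin).ne] with x hx
  refine ⟨?_, ?_⟩
  · refine AEStronglyMeasurable.mul ?_ hf.1
    have := measurable_ker α
    exact (by fun_prop : Measurable fun y => ((ker α (x - y) : ℝ) : ℂ)).aestronglyMeasurable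
  · have := (ENNReal.rpow_lt_top_iff_of_pos (zero_lt_two (α := ℝ))).1 hx
    simpa [HasFiniteIntegral, enorm_mul, enorm_ofReal_eq] using this

theorem fracFun_ae (α : ℝ) (f : ℝ → ℂ) :
    fracFun α f =ᵐ[unitMeasure] fun x => ∫ y, ((ker α (x - y) : ℝ) : ℂ) * f y ∂unitMeasure :=
  (ae_restrict_iff' measurableSet_Icc).2 (Eventually.of_forall fun _ hx => fracFun_eq α f hx)

theorem eLpNorm_fracFun_le (α : ℝ) {f : ℝ → ℂ} (hf : AEStronglyMeasurable f unitMeasure) :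
    eLpNorm (fracFun α f) 2 unitMeasure ≤ (∫⁻ s, ‖ker α s‖ₑ) * eLpNorm f 2 unitMeasure := by
  rw [eLpNorm_congr_ae (fracFun_ae α f), eLpNorm_eq_lintegral_rpow_enorm_toReal two_ne_zero
    ENNReal.ofNat_ne_top, eLpNorm_eq_lintegral_rpow_enorm_toReal two_ne_zero ENNReal.ofNat_ne_top]
  simp only [ENNReal.toReal_ofNat]
  have h2 : ∀ a : ℝ≥0∞, (a ^ (2 : ℝ)) ^ (1 / 2 : ℝ) = a := fun a => by
    rw [← ENNReal.rpow_mul]; norm_num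
  calc _ ≤ ((∫⁻ s, ‖ker α s‖ₑ) ^ (2 : ℝ) *
        ∫⁻ y, ‖f y‖ₑ ^ (2 : ℝ) ∂unitMeasure) ^ (1 / 2 : ℝ) := by
        refine ENNReal.rpow_le_rpow ?_ (by norm_num)
        refine le_trans (lintegral_mono fun x => ?_) (schur (measurable_ker α) hf)
        refine ENNReal.rpow_le_rpow ?_ zero_le_two
        refine (enorm_integral_le_lintegral_enorm _).trans (le_of_eq ?_)
        simp [enorm_mul, enorm_ofReal_eq]
    _ = _ := by rw [ENNReal.mul_rpow_of_nonneg _ _ (by norm_num), h2]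

theorem memLp_fracFun {α : ℝ} (hα : 0 < α) {f : ℝ → ℂ} (hf : MemLp f 2 unitMeasure) :
    MemLp (fracFun α f) 2 unitMeasure := by
  refine ⟨?_, (eLpNorm_fracFun_le α hf.1).trans_lt
    (ENNReal.mul_lt_top (integrable_ker hα).2 hf.2)⟩
  refine AEStronglyMeasurable.congr ?_ (fracFun_ae α f).symm
  refine AEStronglyMeasurable.integral_prod_right'
    (f := fun p : ℝ × ℝ => ((ker α (p.1 - p.2) : ℝ) : ℂ) * f p.2) ?_
  refine AEStronglyMeasurable.mul ?_ hf.1.comp_snd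
  have := measurable_ker α
  exact (by fun_prop : Measurable fun p : ℝ × ℝ =>
    ((ker α (p.1 - p.2) : ℝ) : ℂ)).aestronglyMeasurable

/-- The modified fractional Volterra operator `L^α`, `α > 0`, as a linear map of `L²([0,1])`. -/
def fracLin (α : ℝ) (hα : 0 < α) : L2 →ₗ[ℂ] L2 where
  toFun f := (memLp_fracFun hα (Lp.memLp f)).toLp (fracFun α f)
  map_add' f g := by
    rw [← MemLp.toLp_add, MemLp.toLp_eq_toLp_iff]
    filter_upwards [fracFun_ae α (f + g : L2), fracFun_ae α f, fracFun_ae α g,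
      ae_integrable hα (Lp.memLp f), ae_integrable hα (Lp.memLp g)] with x h h1 h2 i1 i2
    rw [Pi.add_apply, h, h1, h2, ← integral_add i1 i2]
    refine integral_congr_ae ?_
    filter_upwards [Lp.coeFn_add f g] with y hy
    rw [hy, Pi.add_apply, mul_add]
  map_smul' c f := by
    rw [RingHom.id_apply, ← MemLp.toLp_const_smul, MemLp.toLp_eq_toLp_iff]
    filter_upwards [fracFun_ae α (c • f : L2), fracFun_ae α f] with x h h1
    rw [Pi.smul_apply, h, h1, smul_eq_mul, ← integral_const_mul]
    refine integral_congr_ae ?_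
    filter_upwards [Lp.coeFn_smul c f] with y hy
    rw [hy, Pi.smul_apply, smul_eq_mul]
    ring

/-- The modified fractional Volterra operator `L^α` as a bounded operator on `L²([0,1])`
(only `α > 0` is meaningful; the value is `0` otherwise). -/
def frac (α : ℝ) : L2 →L[ℂ] L2 :=
  if hα : 0 < α then
    (fracLin α hα).mkContinuous (∫⁻ s, ‖ker α s‖ₑ).toReal fun f => by
      change ‖(memLp_fracFun hα (Lp.memLp f)).toLp (fracFun α f)‖ ≤ _
      rw [Lp.norm_toLp, Lp.norm_def, ← ENNReal.toReal_mul]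
      exact ENNReal.toReal_mono
        (ENNReal.mul_lt_top (integrable_ker hα).2 (Lp.memLp f).2).ne
        (eLpNorm_fracFun_le α (Lp.memLp f).1)
  else 0

theorem frac_ae {α : ℝ} (hα : 0 < α) (f : L2) : frac α f =ᵐ[unitMeasure] fracFun α f := by
  rw [frac, dif_pos hα]
  exact MemLp.coeFn_toLp (memLp_fracFun hα (Lp.memLp f))

/-- `A = -∫_0^{1/2} L^α dα`, a Bochner integral in the space of bounded operators. -/
def opA : L2 →L[ℂ] L2 := -∫ α in (0 : ℝ)..(1 / 2), frac α

/-- `T = e^A`. -/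
def opT : L2 →L[ℂ] L2 := NormedSpace.exp opA

end ModVolterra

end

/-!
Compression to `L²([0, 1])` is a contractive functional calculus on the causal Fourier
multipliers: causality makes it multiplicative. It sends the symbol
`S ξ = ∫ α in 0..1/2, (1 + 2πiξ) ^ (-α)` to `-A`, so that `‖A * exp (t • A)‖` is at most
`sup |S| exp (-t Re S)`. The values of `S` approach `0` tangentially to the positive real axis, and
`x * exp (-x) ≤ 1 / e` gives the asymptotic bounds. Conjugation by multiplication with `exp (-l x)`
turns the symbol into `S` with `1` replaced by `1 + l`, hence makes `A` arbitrarily small without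
changing its spectrum, while `Re S > 0` prevents `A` and `1 - T` from vanishing.
-/

namespace ModVolterra

open scoped BoundedContinuousFunction FourierTransform SchwartzMap Convolution

section Multiplication

variable {X : Type*} [TopologicalSpace X] [MeasurableSpace X] [BorelSpace X] {p : ℝ≥0∞}
  [Fact (1 ≤ p)]

/-- Multiplication by a bounded continuous function, as an operator on `L^p(μ)`. -/
noncomputable def mulCLM (p : ℝ≥0∞) [Fact (1 ≤ p)] (μ : Measure X) (m : X →ᵇ ℂ) :
    Lp ℂ p μ →L[ℂ] Lp ℂ p μ :=
  (ContinuousLinearMap.mul ℂ ℂ).holderL μ ∞ p p (m.memLp_top.toLp m)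

theorem coeFn_mulCLM {μ : Measure X} (m : X →ᵇ ℂ) (f : Lp ℂ p μ) :
    mulCLM p μ m f =ᵐ[μ] fun x => m x * f x := by
  filter_upwards [(ContinuousLinearMap.mul ℂ ℂ).coeFn_holder (r := p) (m.memLp_top.toLp m) f,
    m.memLp_top.coeFn_toLp (μ := μ)] with x hx hm
  rw [ContinuousLinearMap.mul_apply', hm] at hx
  exact hx

/-- The representation of the algebra of bounded continuous functions on `L^p(μ)` by
multiplication operators. -/
noncomputable def mulOp (p : ℝ≥0∞) [Fact (1 ≤ p)] (μ : Measure X) :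
    (X →ᵇ ℂ) →ₐ[ℂ] (Lp ℂ p μ →L[ℂ] Lp ℂ p μ) :=
  AlgHom.ofLinearMap
    { toFun := mulCLM p μ
      map_add' := fun m n => by
        rw [mulCLM, mulCLM, mulCLM, ← map_add, ← MemLp.toLp_add]; rfl
      map_smul' := fun c m => by
        rw [mulCLM, mulCLM, RingHom.id_apply, ← map_smul, ← MemLp.toLp_const_smul]; rfl }
    (by
      ext f
      filter_upwards [coeFn_mulCLM 1 f] with x hx
      exact hx.trans (one_mul _))
    (fun m n => by
      ext f
      filter_upwards [coeFn_mulCLM (m * n) f, coeFn_mulCLM m (mulCLM p μ n f),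
        coeFn_mulCLM n f] with x h₁ h₂ h₃
      rw [h₃, ← mul_assoc] at h₂
      exact h₁.trans h₂.symm)

theorem coeFn_mulOp {μ : Measure X} (m : X →ᵇ ℂ) (f : Lp ℂ p μ) :
    mulOp p μ m f =ᵐ[μ] fun x => m x * f x :=
  coeFn_mulCLM m f

theorem norm_mulOp_le {μ : Measure X} (m : X →ᵇ ℂ) : ‖mulOp p μ m‖ ≤ ‖m‖ :=
  ContinuousLinearMap.opNorm_le_bound _ (norm_nonneg m) fun f => by
    refine Lp.norm_le_mul_norm_of_ae_le_mul ?_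
    filter_upwards [coeFn_mulOp m f] with x hx
    rw [hx, norm_mul]
    gcongr
    exact m.norm_coe_le_norm x

end Multiplication

section Restriction

variable {X : Type*} [MeasurableSpace X] {μ : Measure X} {s : Set X}

/-- Restriction of square integrable functions to a set. -/
noncomputable abbrev restrictL2 (μ : Measure X) (s : Set X) :
    Lp ℂ 2 μ →L[ℂ] Lp ℂ 2 (μ.restrict s) :=
  LpToLpRestrictCLM X ℂ ℂ μ 2 s

theorem coeFn_restrictL2 (s : Set X) (f : Lp ℂ 2 μ) : restrictL2 μ s f =ᵐ[μ.restrict s] f :=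
  LpToLpRestrictCLM_coeFn ℂ s f

theorem norm_restrictL2_le (s : Set X) : ‖restrictL2 μ s‖ ≤ 1 :=
  LinearMap.mkContinuous_norm_le _ zero_le_one _

/-- Extension by zero of square integrable functions on a set, encoded as the adjoint of the
restriction. -/
noncomputable def extendL2 (μ : Measure X) (s : Set X) : Lp ℂ 2 (μ.restrict s) →L[ℂ] Lp ℂ 2 μ :=
  ContinuousLinearMap.adjoint (restrictL2 μ s)

theorem norm_extendL2_le (s : Set X) : ‖extendL2 μ s‖ ≤ 1 := by
  rw [extendL2, LinearIsometryEquiv.norm_map]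
  exact norm_restrictL2_le s

theorem coeFn_extendL2 (hs : MeasurableSet s) (f : Lp ℂ 2 (μ.restrict s)) :
    extendL2 μ s f =ᵐ[μ] s.indicator f := by
  have hf : MemLp (s.indicator f) 2 μ := (memLp_indicator_iff_restrict hs).2 (Lp.memLp f)
  suffices extendL2 μ s f = hf.toLp _ by rw [this]; exact hf.coeFn_toLp
  refine ext_inner_left ℂ fun g => ?_
  calc inner ℂ g (extendL2 μ s f) = ∫ x in s, inner ℂ (g x) (f x) ∂μ := by
        rw [extendL2, ContinuousLinearMap.adjoint_inner_right, L2.inner_def]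
        refine integral_congr_ae ?_
        filter_upwards [coeFn_restrictL2 s g] with x hx
        rw [hx]
    _ = ∫ x, inner ℂ (g x) (s.indicator f x) ∂μ := by
        rw [← integral_indicator hs]
        refine integral_congr_ae (Eventually.of_forall fun x => ?_)
        by_cases hx : x ∈ s <;> simp [hx]
    _ = inner ℂ g (hf.toLp _) := by
        rw [L2.inner_def]
        refine integral_congr_ae ?_
        filter_upwards [hf.coeFn_toLp] with x hx
        rw [hx]

theorem restrictL2_extendL2 (hs : MeasurableSet s) (f : Lp ℂ 2 (μ.restrict s)) :
    restrictL2 μ s (extendL2 μ s f) = f := by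
  ext1
  filter_upwards [coeFn_restrictL2 s (extendL2 μ s f), ae_restrict_of_ae (coeFn_extendL2 hs f),
    ae_restrict_mem hs] with x h1 h2 hx
  rw [h1, h2, Set.indicator_of_mem hx]

theorem coeFn_extendL2_restrictL2 (hs : MeasurableSet s) (f : Lp ℂ 2 μ) :
    extendL2 μ s (restrictL2 μ s f) =ᵐ[μ] s.indicator f := by
  filter_upwards [coeFn_extendL2 hs (restrictL2 μ s f),
    (ae_restrict_iff' hs).1 (coeFn_restrictL2 s f)] with x h₁ h₂
  by_cases hx : x ∈ s
  · rw [h₁, Set.indicator_of_mem hx, Set.indicator_of_mem hx, h₂ hx]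
  · rw [h₁, Set.indicator_of_notMem hx, Set.indicator_of_notMem hx]

theorem nontrivial_Lp_restrict {p : ℝ≥0∞} [Fact (1 ≤ p)] (hs₀ : μ s ≠ 0) (hs : μ s ≠ ⊤) :
    Nontrivial (Lp ℂ p (μ.restrict s)) := by
  have : IsFiniteMeasure (μ.restrict s) := isFiniteMeasure_restrict.2 hs
  have : NeZero (μ.restrict s) := ⟨mt Measure.restrict_eq_zero.1 hs₀⟩
  have hp : p ≠ 0 := (one_pos.trans_le Fact.out).ne'
  refine nontrivial_of_ne (Lp.const p (μ.restrict s) (1 : ℂ)) 0 (norm_ne_zero_iff.1 ?_)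
  refine (Lp.norm_const p (μ.restrict s) (1 : ℂ) hp).trans_ne ?_
  rw [norm_one, one_mul]
  exact (Real.rpow_pos_of_pos measureReal_univ_pos _).ne'

end Restriction

section FourierL2

variable {E : Type*} [NormedAddCommGroup E] [InnerProductSpace ℝ E] [FiniteDimensional ℝ E]
  [MeasurableSpace E] [BorelSpace E]

theorem ae_eq_of_integral_schwartz_smul_eq {f g : E → ℂ} (hf : LocallyIntegrable f)
    (hg : LocallyIntegrable g) (h : ∀ φ : 𝓢(E, ℂ), ∫ x, φ x • f x = ∫ x, φ x • g x) :
    f =ᵐ[volume] g := by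
  refine ae_eq_of_integral_contDiff_smul_eq hf hg fun u hu hsupp => ?_
  have hu' : HasCompactSupport fun x => (u x : ℂ) := hsupp.comp_left Complex.ofReal_zero
  simpa using! h (hu'.toSchwartzMap (Complex.ofRealCLM.contDiff.comp hu))

theorem integral_schwartz_smul_fourier (φ : 𝓢(E, ℂ)) (f : Lp (α := E) ℂ 2) :
    ∫ ξ, φ ξ • (𝓕 f : Lp (α := E) ℂ 2) ξ = ∫ x, (𝓕 φ) x • f x := by
  simpa only [TemperedDistribution.fourier_apply, Lp.toTemperedDistribution_apply] using
    congrArg (fun u => u φ) (Lp.fourier_toTemperedDistribution_eq f).symm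

theorem integral_schwartz_smul_fourier_of_integrable (φ : 𝓢(E, ℂ)) {f : E → ℂ}
    (hf : Integrable f) : ∫ ξ, φ ξ • 𝓕 f ξ = ∫ x, (𝓕 φ) x • f x := by
  have hφ : Integrable φ volume := φ.integrable
  simpa using! (VectorFourier.integral_fourierIntegral_smul_eq_flip (L := innerₗ E)
    Real.continuous_fourierChar continuous_inner hφ hf).symm

theorem continuous_fourier_of_integrable {f : E → ℂ} (hf : Integrable f) : Continuous (𝓕 f) :=
  VectorFourier.fourierIntegral_continuous Real.continuous_fourierChar continuous_inner hf

theorem locallyIntegrable_coeFn (f : Lp (α := E) ℂ 2) : LocallyIntegrable f :=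
  (Lp.memLp f).locallyIntegrable one_le_two

theorem fourier_ae_eq_iff (f : Lp (α := E) ℂ 2) {g : E → ℂ} (hg : Integrable g) :
    (𝓕 f : Lp (α := E) ℂ 2) =ᵐ[volume] 𝓕 g ↔ f =ᵐ[volume] g := by
  refine ⟨fun h => ?_, fun h => ?_⟩
  · refine ae_eq_of_integral_schwartz_smul_eq (locallyIntegrable_coeFn f)
      hg.locallyIntegrable fun φ => ?_
    obtain ⟨ψ, rfl⟩ : ∃ ψ : 𝓢(E, ℂ), 𝓕 ψ = φ := ⟨𝓕⁻ φ, FourierTransform.fourier_fourierInv_eq φ⟩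
    rw [← integral_schwartz_smul_fourier, ← integral_schwartz_smul_fourier_of_integrable ψ hg]
    exact integral_congr_ae (h.mono fun x hx => by simp only [hx])
  · refine ae_eq_of_integral_schwartz_smul_eq (locallyIntegrable_coeFn _)
      (continuous_fourier_of_integrable hg).locallyIntegrable fun φ => ?_
    rw [integral_schwartz_smul_fourier, integral_schwartz_smul_fourier_of_integrable φ hg]
    exact integral_congr_ae (h.mono fun x hx => by simp only [hx])

/-- The Fourier multiplier with a given symbol, as a representation of the algebra of bounded
continuous functions on `L²`. -/
noncomputable def fourierMultiplier :
    (E →ᵇ ℂ) →ₐ[ℂ] (Lp (α := E) ℂ 2 →L[ℂ] Lp (α := E) ℂ 2) :=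
  ((Lp.fourierTransformₗᵢ E ℂ).symm.toContinuousLinearEquiv.conjContinuousAlgEquiv :
    (Lp (α := E) ℂ 2 →L[ℂ] Lp (α := E) ℂ 2) →ₐ[ℂ] (Lp (α := E) ℂ 2 →L[ℂ] Lp (α := E) ℂ 2)).comp
    (mulOp 2 volume)

theorem fourierMultiplier_apply (m : E →ᵇ ℂ) (f : Lp (α := E) ℂ 2) :
    fourierMultiplier m f = 𝓕⁻ (mulOp 2 volume m (𝓕 f)) := rfl

theorem fourier_fourierMultiplier (m : E →ᵇ ℂ) (f : Lp (α := E) ℂ 2) :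
    𝓕 (fourierMultiplier m f) = mulOp 2 volume m (𝓕 f) := by
  rw [fourierMultiplier_apply, FourierTransform.fourier_fourierInv_eq]

theorem norm_fourierMultiplier_le (m : E →ᵇ ℂ) : ‖fourierMultiplier m‖ ≤ ‖m‖ :=
  ContinuousLinearMap.opNorm_le_bound _ (norm_nonneg m) fun f => by
    rw [← Lp.norm_fourier_eq, fourier_fourierMultiplier, ← Lp.norm_fourier_eq f]
    exact ContinuousLinearMap.le_of_opNorm_le _ (norm_mulOp_le m) _

/-- The Fourier transform of an integrable function, as a bounded continuous function. -/
noncomputable def fourierSymbol {k : E → ℂ} (hk : Integrable k) : E →ᵇ ℂ :=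
  BoundedContinuousFunction.ofNormedAddCommGroup (𝓕 k) (continuous_fourier_of_integrable hk)
    (∫ x, ‖k x‖) fun _ => VectorFourier.norm_fourierIntegral_le_integral_norm _ _ _ _ _

theorem norm_fourierSymbol_le {k : E → ℂ} (hk : Integrable k) :
    ‖fourierSymbol hk‖ ≤ ∫ x, ‖k x‖ :=
  BoundedContinuousFunction.norm_ofNormedAddCommGroup_le _
    (integral_nonneg fun _ => norm_nonneg _) _

theorem fourierMultiplier_fourierSymbol {k : E → ℂ} (hk : Integrable k) {f : Lp (α := E) ℂ 2}
    (hf : Integrable f) :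
    fourierMultiplier (fourierSymbol hk) f =ᵐ[volume] k ⋆[ContinuousLinearMap.mul ℂ ℂ] f := by
  rw [← fourier_ae_eq_iff _ (hk.integrable_convolution _ hf), fourier_fourierMultiplier]
  filter_upwards [coeFn_mulOp (fourierSymbol hk) (𝓕 f), (fourier_ae_eq_iff f hf).2 .rfl]
    with ξ h₁ h₂
  rw [h₁, h₂, Real.fourier_mul_convolution_eq hk hf]
  rfl

end FourierL2

section Compression

variable {E : Type*} [NormedAddCommGroup E] [InnerProductSpace ℝ E] [FiniteDimensional ℝ E]
  [MeasurableSpace E] [BorelSpace E] {s : Set E}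

theorem norm_restrictL2_comp_fourierMultiplier_comp_extendL2_le (m : E →ᵇ ℂ) :
    ‖restrictL2 volume s ∘L fourierMultiplier m ∘L extendL2 volume s‖ ≤ ‖m‖ :=
  calc ‖restrictL2 volume s ∘L fourierMultiplier m ∘L extendL2 volume s‖
      ≤ ‖restrictL2 volume s‖ * (‖fourierMultiplier m‖ * ‖extendL2 volume s‖) :=
        (ContinuousLinearMap.opNorm_comp_le _ _).trans
          (by gcongr; exact ContinuousLinearMap.opNorm_comp_le _ _)
    _ ≤ 1 * (‖m‖ * 1) := by
        gcongr
        exacts [norm_restrictL2_le s, norm_fourierMultiplier_le m, norm_extendL2_le s]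
    _ = ‖m‖ := by ring

/-- The compression to `L²(s)` of the Fourier multiplier with a given symbol. -/
noncomputable def compression (s : Set E) :
    (E →ᵇ ℂ) →L[ℂ] (Lp ℂ 2 (volume.restrict s) →L[ℂ] Lp ℂ 2 (volume.restrict s)) :=
  LinearMap.mkContinuous
    { toFun := fun m => restrictL2 volume s ∘L fourierMultiplier m ∘L extendL2 volume s
      map_add' := fun m n => by simp
      map_smul' := fun c m => by simp }
    1 fun m => (norm_restrictL2_comp_fourierMultiplier_comp_extendL2_le m).trans_eq
      (one_mul _).symm

theorem compression_apply (m : E →ᵇ ℂ) (f : Lp ℂ 2 (volume.restrict s)) :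
    compression s m f = restrictL2 volume s (fourierMultiplier m (extendL2 volume s f)) := rfl

theorem norm_compression_le (m : E →ᵇ ℂ) : ‖compression s m‖ ≤ ‖m‖ :=
  norm_restrictL2_comp_fourierMultiplier_comp_extendL2_le m

theorem compression_one (hs : MeasurableSet s) : compression s 1 = 1 := by
  ext1 f
  rw [compression_apply, map_one]
  exact restrictL2_extendL2 hs f

theorem compression_fourierSymbol (hs : MeasurableSet s) (hs' : volume s ≠ ⊤) {k : E → ℂ}
    (hk : Integrable k) (f : Lp ℂ 2 (volume.restrict s)) :
    compression s (fourierSymbol hk) f =ᵐ[volume.restrict s]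
      fun x => ∫ y in s, k (x - y) * f y := by
  have : IsFiniteMeasure (volume.restrict s) := ⟨by simpa using hs'.lt_top⟩
  have hf : Integrable (s.indicator f) :=
    (integrable_indicator_iff hs).2 ((Lp.memLp f).integrable one_le_two)
  have hEf := coeFn_extendL2 hs f
  filter_upwards [coeFn_restrictL2 s (fourierMultiplier (fourierSymbol hk) (extendL2 volume s f)),
    ae_restrict_of_ae (fourierMultiplier_fourierSymbol hk (hf.congr hEf.symm))] with x h₁ h₂
  rw [compression_apply, h₁, h₂, convolution_eq_swap, ← integral_indicator hs]
  refine integral_congr_ae (hEf.mono fun y hy => ?_)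
  by_cases hys : y ∈ s <;> simp [hy, hys]

/-- The square integrable functions that vanish on a set. -/
noncomputable abbrev vanishingOn (s : Set E) : Submodule ℂ (Lp ℂ 2 (volume : Measure E)) :=
  (restrictL2 volume s).ker

theorem mem_vanishingOn {f : Lp ℂ 2 (volume : Measure E)} :
    f ∈ vanishingOn s ↔ f =ᵐ[volume.restrict s] 0 := by
  rw [LinearMap.mem_ker, Lp.ext_iff]
  have h0 := Lp.coeFn_zero ℂ 2 (volume.restrict s)
  have hf := coeFn_restrictL2 s f
  exact ⟨fun h => hf.symm.trans (h.trans h0), fun h => hf.trans (h.trans h0.symm)⟩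

theorem isClosed_vanishingOn : IsClosed (vanishingOn s : Set (Lp ℂ 2 (volume : Measure E))) :=
  (restrictL2 volume s).isClosed_ker

theorem continuous_fourierMultiplier :
    Continuous (fourierMultiplier : (E →ᵇ ℂ) →ₐ[ℂ] _) :=
  AddMonoidHomClass.continuous_of_bound _ 1 fun m => by
    rw [one_mul]
    exact norm_fourierMultiplier_le m

theorem map_mem_vanishingOn_of_integrable (hs : MeasurableSet s)
    {T : Lp ℂ 2 (volume : Measure E) →L[ℂ] Lp ℂ 2 (volume : Measure E)}
    (hT : ∀ f ∈ vanishingOn s, Integrable f → T f ∈ vanishingOn s) :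
    ∀ f ∈ vanishingOn s, T f ∈ vanishingOn s := by
  intro f hf
  let Q := extendL2 volume sᶜ ∘L restrictL2 volume sᶜ
  have hQ (g : Lp ℂ 2 (volume : Measure E)) : Q g =ᵐ[volume] sᶜ.indicator g :=
    coeFn_extendL2_restrictL2 hs.compl g
  have hfQ : Q f = f := by
    ext1
    filter_upwards [hQ f, (ae_restrict_iff' hs).1 (mem_vanishingOn.1 hf)] with x h₁ h₂
    by_cases hx : x ∈ s <;> simp [h₁, h₂, hx]
  rw [← hfQ]
  refine (SchwartzMap.denseRange_toLpCLM (F := ℂ) (p := 2) (μ := (volume : Measure E))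
    ENNReal.ofNat_ne_top).induction_on (p := fun g => T (Q g) ∈ vanishingOn s) f
    (isClosed_vanishingOn.preimage (T.continuous.comp Q.continuous)) fun φ => ?_
  have hφ := hQ (SchwartzMap.toLpCLM ℝ ℂ 2 volume φ)
  refine hT _ (mem_vanishingOn.2 ?_) ?_
  · filter_upwards [ae_restrict_of_ae hφ, ae_restrict_mem hs] with x h hx
    rw [h, Set.indicator_of_notMem (Set.notMem_compl_iff.2 hx), Pi.zero_apply]
  · refine Integrable.congr ?_ hφ.symm
    exact (φ.integrable.congr (SchwartzMap.coeFn_toLp φ 2 volume).symm).indicator hs.compl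

end Compression

section CausalCompression

/-- The symbols whose Fourier multiplier is causal: it does not move the support of a function
to the left. -/
noncomputable def causalMultipliers : Subalgebra ℂ (ℝ →ᵇ ℂ) where
  carrier := {m | ∀ a, ∀ f ∈ vanishingOn (Set.Iio a), fourierMultiplier m f ∈
    vanishingOn (Set.Iio a)}
  mul_mem' hm hn a f hf := by
    rw [map_mul]
    exact hm a _ (hn a f hf)
  add_mem' hm hn a f hf := by
    rw [map_add]
    exact add_mem (hm a f hf) (hn a f hf)
  algebraMap_mem' c a f hf := by
    rw [AlgHom.commutes]
    exact Submodule.smul_mem _ c hf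

theorem isClosed_causalMultipliers : IsClosed (causalMultipliers : Set (ℝ →ᵇ ℂ)) := by
  have : (causalMultipliers : Set (ℝ →ᵇ ℂ)) = ⋂ (a : ℝ) (f ∈ vanishingOn (Set.Iio a)),
      {m | fourierMultiplier m f ∈ vanishingOn (Set.Iio a)} := by
    ext m
    simp only [Set.mem_iInter]
    rfl
  rw [this]
  exact isClosed_iInter fun a => isClosed_biInter fun f _ => isClosed_vanishingOn.preimage
    (continuous_fourierMultiplier.clm_apply continuous_const)

instance : CompleteSpace causalMultipliers :=
  isClosed_causalMultipliers.completeSpace_coe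

theorem fourierSymbol_mem_causalMultipliers {k : ℝ → ℂ} (hk : Integrable k)
    (hk0 : ∀ x < 0, k x = 0) : fourierSymbol hk ∈ causalMultipliers := by
  refine fun a => map_mem_vanishingOn_of_integrable measurableSet_Iio fun f hf hfi => ?_
  rw [mem_vanishingOn, EventuallyEq, ae_restrict_iff' measurableSet_Iio] at hf ⊢
  filter_upwards [fourierMultiplier_fourierSymbol hk hfi] with x hx hxa
  rw [hx, convolution_eq_swap, Pi.zero_apply]
  refine integral_eq_zero_of_ae (hf.mono fun y hy => ?_)
  rcases lt_or_ge y a with hya | hya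
  · simp [hy hya]
  · simp [hk0 (x - y) (by linarith [Set.mem_Iio.1 hxa])]

theorem compression_Icc_mul (a b : ℝ) {m n : ℝ →ᵇ ℂ} (hm : m ∈ causalMultipliers)
    (hn : n ∈ causalMultipliers) :
    compression (Set.Icc a b) (m * n) =
      compression (Set.Icc a b) m * compression (Set.Icc a b) n := by
  ext1 f
  set g := fourierMultiplier n (extendL2 volume (Set.Icc a b) f)
  set P := extendL2 volume (Set.Icc a b) (restrictL2 volume (Set.Icc a b) g)
  have hgP : g - P ∈ vanishingOn (Set.Iio b) := by
    have hga : g ∈ vanishingOn (Set.Iio a) := by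
      refine hn a _ (mem_vanishingOn.2 ?_)
      filter_upwards [ae_restrict_of_ae (coeFn_extendL2 measurableSet_Icc f),
        ae_restrict_mem measurableSet_Iio] with x h hx
      rw [h, Set.indicator_of_notMem fun h => h.1.not_gt hx, Pi.zero_apply]
    rw [mem_vanishingOn, EventuallyEq, ae_restrict_iff' measurableSet_Iio] at hga ⊢
    filter_upwards [hga, Lp.coeFn_sub g P,
      coeFn_extendL2_restrictL2 measurableSet_Icc g] with x h₁ h₂ h₃ hxb
    rw [h₂, Pi.sub_apply, h₃]
    rcases lt_or_ge x a with hxa | hxa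
    · simp [h₁ hxa, hxa]
    · simp [hxa, (Set.mem_Iio.1 hxb).le]
  have hMgP : fourierMultiplier m (g - P) ∈ vanishingOn (Set.Icc a b) := by
    rw [mem_vanishingOn, ← restrict_Ico_eq_restrict_Icc]
    exact ae_restrict_of_ae_restrict_of_subset (fun _ hx => hx.2) (mem_vanishingOn.1 (hm b _ hgP))
  rw [LinearMap.mem_ker, map_sub, map_sub, sub_eq_zero] at hMgP
  rw [compression_apply, map_mul]
  exact hMgP

/-- The compression to `L²([a, b])` of causal Fourier multipliers. Causality makes it
multiplicative, so that it is a functional calculus. -/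
noncomputable def causalCompression (a b : ℝ) : causalMultipliers →A[ℂ]
    (Lp ℂ 2 (volume.restrict (Set.Icc a b)) →L[ℂ] Lp ℂ 2 (volume.restrict (Set.Icc a b))) where
  toAlgHom := AlgHom.ofLinearMap
    ((compression (Set.Icc a b)).toLinearMap ∘ₗ causalMultipliers.val.toLinearMap)
    (compression_one measurableSet_Icc) fun m n => compression_Icc_mul a b m.2 n.2
  cont := (compression (Set.Icc a b)).continuous.comp continuous_subtype_val

theorem norm_causalCompression_le (a b : ℝ) (m : causalMultipliers) :
    ‖causalCompression a b m‖ ≤ ‖m‖ :=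
  norm_compression_le (m : ℝ →ᵇ ℂ)

theorem causalCompression_exp (a b : ℝ) (m : causalMultipliers) :
    causalCompression a b (NormedSpace.exp m) = NormedSpace.exp (causalCompression a b m) := by
  let := NormedAlgebra.restrictScalars ℚ ℂ causalMultipliers
  exact NormedSpace.map_exp _ (causalCompression a b).continuous m

theorem exp_causalMultiplier_apply (m : causalMultipliers) (ξ : ℝ) :
    (NormedSpace.exp m : causalMultipliers).1 ξ = Complex.exp (m.1 ξ) := by
  let := NormedAlgebra.restrictScalars ℚ ℂ causalMultipliers
  let ev : causalMultipliers →+* ℂ :=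
    ((ContinuousMap.evalAlgHom ℂ ℂ ξ).comp
      ((BoundedContinuousFunction.toContinuousMapₐ ℂ).comp causalMultipliers.val)).toRingHom
  have hev : Continuous ev :=
    (BoundedContinuousFunction.evalCLM ℂ ξ).continuous.comp continuous_subtype_val
  rw [Complex.exp_eq_exp_ℂ]
  exact NormedSpace.map_exp ev hev m

end CausalCompression

section Gamma

open ProbabilityTheory

theorem integral_gammaMeasure {F : Type*} [NormedAddCommGroup F] [NormedSpace ℝ F] {a r : ℝ}
    (ha : 0 < a) (hr : 0 < r) (f : ℝ → F) :
    ∫ x, f x ∂gammaMeasure a r = ∫ x, gammaPDFReal a r x • f x := by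
  have hm : Measurable (gammaPDF a r) := (measurable_gammaPDFReal a r).ennreal_ofReal
  rw [gammaMeasure, integral_withDensity_eq_integral_toReal_smul hm
    (ae_of_all _ fun x => ENNReal.ofReal_lt_top)]
  simp only [gammaPDF, ENNReal.toReal_ofReal (gammaPDFReal_nonneg ha hr _)]

theorem mgf_gammaMeasure {a r t : ℝ} (ha : 0 < a) (hr : 0 < r) (ht : t < r) :
    mgf id (gammaMeasure a r) t = (1 - t / r) ^ (-a) := by
  have hrt : 0 < r - t := sub_pos.2 ht
  have hpdf (x : ℝ) : gammaPDFReal a r x • Real.exp (t * x) = (Set.Ici 0).indicator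
      (fun x => r ^ a / Real.Gamma a * (x ^ (a - 1) * Real.exp (-((r - t) * x)))) x := by
    by_cases hx : 0 ≤ x
    · rw [gammaPDFReal, if_pos hx, Set.indicator_of_mem (Set.mem_Ici.2 hx), smul_eq_mul,
        mul_assoc _ (Real.exp _), ← Real.exp_add, mul_assoc]
      ring_nf
    · simp [gammaPDFReal, hx]
  calc mgf id (gammaMeasure a r) t = ∫ x, gammaPDFReal a r x • Real.exp (t * x) :=
        integral_gammaMeasure ha hr _
    _ = r ^ a / Real.Gamma a * ((1 / (r - t)) ^ a * Real.Gamma a) := by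
        simp_rw [hpdf]
        rw [integral_indicator measurableSet_Ici, integral_Ici_eq_integral_Ioi,
          integral_const_mul, Real.integral_rpow_mul_exp_neg_mul_Ioi ha hrt]
    _ = (r / (r - t)) ^ a := by
        rw [div_mul_eq_mul_div, ← mul_assoc, mul_div_assoc, div_self (Real.Gamma_pos_of_pos ha).ne',
          mul_one, ← Real.mul_rpow hr.le (by positivity), mul_one_div]
    _ = (1 - t / r) ^ (-a) := by
        rw [Real.rpow_neg_eq_inv_rpow, one_sub_div hr.ne', inv_div]

theorem mem_integrableExpSet_gammaMeasure {a r t : ℝ} (ha : 0 < a) (hr : 0 < r) (ht : t < r) :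
    t ∈ integrableExpSet id (gammaMeasure a r) := by
  by_contra h
  have h0 := mgf_gammaMeasure ha hr ht
  rw [mgf_undef h] at h0
  exact (Real.rpow_pos_of_pos (sub_pos.2 ((div_lt_one hr).2 ht)) _).ne h0

theorem complexMGF_gammaMeasure {a r : ℝ} {z : ℂ} (ha : 0 < a) (hr : 0 < r) (hz : z.re < r) :
    complexMGF id (gammaMeasure a r) z = (1 - z / r) ^ (-(a : ℂ)) := by
  set U : Set ℂ := {z | z.re < r}
  have hUo : IsOpen U := isOpen_lt Complex.continuous_re continuous_const
  have hmgf : AnalyticOnNhd ℂ (complexMGF id (gammaMeasure a r)) U := fun z hz =>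
    analyticAt_complexMGF (mem_interior_iff_mem_nhds.2 (Filter.mem_of_superset
      (Iio_mem_nhds hz) fun t ht => mem_integrableExpSet_gammaMeasure ha hr ht))
  have hpow : AnalyticOnNhd ℂ (fun z : ℂ => (1 - z / r) ^ (-(a : ℂ))) U := by
    refine DifferentiableOn.analyticOnNhd (fun z hz => ?_) hUo
    refine (DifferentiableAt.cpow (by fun_prop) (by fun_prop) (Or.inl ?_)).differentiableWithinAt
    simpa using (div_lt_one hr).2 hz
  have hreal (t : ℝ) (ht : t < r) :
      complexMGF id (gammaMeasure a r) t = (1 - (t : ℂ) / r) ^ (-(a : ℂ)) := by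
    rw [complexMGF_ofReal, mgf_gammaMeasure ha hr ht,
      Complex.ofReal_cpow (sub_pos.2 ((div_lt_one hr).2 ht)).le]
    push_cast
    rfl
  refine hmgf.eqOn_of_preconnected_of_frequently_eq hpow
    (convex_halfSpace_re_lt r).isPreconnected (z₀ := 0) (by simpa [U] using hr) ?_ hz
  have hofReal : Tendsto ((↑) : ℝ → ℂ) (𝓝[≠] 0) (𝓝[≠] 0) :=
    tendsto_nhdsWithin_iff.2 ⟨Complex.continuous_ofReal.tendsto' 0 0 rfl |>.mono_left
      nhdsWithin_le_nhds, eventually_mem_nhdsWithin.mono fun t ht => by simpa using ht⟩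
  exact hofReal.frequently
    (eventually_nhdsWithin_of_eventually_nhds ((eventually_lt_nhds hr).mono hreal)).frequently

theorem ker_ae_eq (α : ℝ) : ker α =ᵐ[volume] gammaPDFReal α 1 := by
  filter_upwards [Measure.ae_ne volume (0 : ℝ)] with x hx
  rcases hx.lt_or_gt with hx | hx
  · simp [ker, gammaPDFReal, hx.not_gt, hx.not_ge]
  · simp [ker, gammaPDFReal, hx, hx.le, mul_assoc]

theorem integral_ker_smul {F : Type*} [NormedAddCommGroup F] [NormedSpace ℝ F] {α : ℝ}
    (hα : 0 < α) (f : ℝ → F) : ∫ x, ker α x • f x = ∫ x, f x ∂gammaMeasure α 1 := by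
  rw [integral_gammaMeasure hα one_pos]
  exact integral_congr_ae ((ker_ae_eq α).mono fun x hx => by simp only [hx])

theorem integral_ker_mul_exp {α l : ℝ} (hα : 0 < α) (hl : 0 ≤ l) :
    ∫ x, ker α x * Real.exp (-(l * x)) = (1 + l) ^ (-α) := by
  have h := mgf_gammaMeasure hα one_pos (show -l < 1 by linarith)
  simp only [mgf, id, neg_mul, div_one, sub_neg_eq_add] at h
  rw [← h, ← integral_ker_smul hα]
  rfl

theorem fourier_ker {α : ℝ} (hα : 0 < α) (ξ : ℝ) :
    𝓕 (fun x => (ker α x : ℂ)) ξ = (1 + 2 * Real.pi * ξ * Complex.I) ^ (-(α : ℂ)) := by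
  have h := complexMGF_gammaMeasure (z := -(2 * Real.pi * ξ * Complex.I)) hα one_pos (by simp)
  rw [complexMGF, ← integral_ker_smul hα] at h
  rw [Real.fourier_real_eq_integral_exp_smul]
  calc _ = _ := integral_congr_ae (ae_of_all _ fun x => ?_)
    _ = _ := h
    _ = _ := by simp
  simp only [smul_eq_mul, Complex.real_smul, id]
  rw [mul_comm]
  push_cast
  ring_nf

end Gamma

section Symbol

theorem norm_cpow_neg_sub_le {w : ℂ} (hw : 1 ≤ ‖w‖) {δ α β : ℝ} (hδ : 0 < δ) (hα : δ ≤ α)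
    (hβ : δ ≤ β) :
    ‖w ^ (-(α : ℂ)) - w ^ (-(β : ℂ))‖ ≤ (1 / δ + Real.pi) * |α - β| := by
  have hw0 : 0 < ‖w‖ := one_pos.trans_le hw
  have hderiv (γ : ℝ) : HasDerivAt (fun γ : ℝ => w ^ (-(γ : ℂ)))
      (w ^ (-(γ : ℂ)) * Complex.log w * -1) γ :=
    ((hasDerivAt_neg (γ : ℂ)).const_cpow (Or.inl (norm_pos_iff.1 hw0))).comp_ofReal
  have hlog : ‖Complex.log w‖ ≤ Real.log ‖w‖ + Real.pi := by
    refine (Complex.norm_le_abs_re_add_abs_im _).trans ?_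
    rw [Complex.log_re, Complex.log_im, abs_of_nonneg (Real.log_nonneg hw)]
    gcongr
    exact Complex.abs_arg_le_pi w
  refine (convex_Ici δ).norm_image_sub_le_of_norm_hasDerivWithin_le
    (fun γ _ => (hderiv γ).hasDerivWithinAt) (fun γ hγ => ?_) hβ hα
  calc ‖w ^ (-(γ : ℂ)) * Complex.log w * -1‖
      = ‖w‖ ^ (-γ) * ‖Complex.log w‖ := by
        rw [mul_neg_one, norm_neg, norm_mul, ← Complex.ofReal_neg, Complex.norm_cpow_real]
    _ ≤ ‖w‖ ^ (-δ) * (Real.log ‖w‖ + Real.pi) := by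
        gcongr
        exact hγ
    _ ≤ ‖w‖ ^ (-δ) * (‖w‖ ^ δ / δ) + 1 * Real.pi := by
        rw [mul_add]
        gcongr
        · exact Real.log_le_rpow_div hw0.le hδ
        · exact Real.rpow_le_one_of_one_le_of_nonpos hw (neg_nonpos.2 hδ.le)
    _ = 1 / δ + Real.pi := by
        rw [← mul_div_assoc, ← Real.rpow_add hw0, neg_add_cancel, Real.rpow_zero, one_mul]

/-- The symbol `∫_0^{1/2} w ^ (-α) dα` of `-A` at the point `w` of the right half-plane. -/
noncomputable def cpowIntegral (w : ℂ) : ℂ := ∫ α in (0 : ℝ)..(1 / 2), w ^ (-(α : ℂ))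

/-- The majorant `∫_0^{1/2} r ^ (-α) dα` of `cpowIntegral` on the circle of radius `r`. -/
noncomputable def rpowIntegral (r : ℝ) : ℝ := ∫ α in (0 : ℝ)..(1 / 2), r ^ (-α)

variable {r : ℝ} {w : ℂ}

theorem continuous_rpow_neg (hr : 0 < r) : Continuous fun α : ℝ => r ^ (-α) :=
  continuous_const.rpow continuous_neg fun _ => Or.inl hr.ne'

theorem continuous_mul_rpow_neg (hr : 0 < r) : Continuous fun α : ℝ => α * r ^ (-α) :=
  continuous_id.mul (continuous_rpow_neg hr)

theorem hasDerivAt_rpow_neg (hr : 0 < r) (α : ℝ) :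
    HasDerivAt (fun α : ℝ => r ^ (-α)) (-(Real.log r * r ^ (-α))) α :=
  ((hasDerivAt_neg α).const_rpow hr).congr_deriv (by ring)

theorem rpowIntegral_pos (hr : 0 < r) : 0 < rpowIntegral r :=
  intervalIntegral.intervalIntegral_pos_of_pos ((continuous_rpow_neg hr).intervalIntegrable _ _)
    (fun _ => Real.rpow_pos_of_pos hr _) (by norm_num)

theorem log_mul_rpowIntegral_le_one (hr : 0 < r) : Real.log r * rpowIntegral r ≤ 1 := by
  have h := intervalIntegral.integral_eq_sub_of_hasDerivAt (a := 0) (b := 1 / 2)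
    (fun α _ => hasDerivAt_rpow_neg hr α)
    (((continuous_rpow_neg hr).const_mul _).neg.intervalIntegrable _ _)
  rw [intervalIntegral.integral_neg, intervalIntegral.integral_const_mul, neg_zero,
    Real.rpow_zero] at h
  have := Real.rpow_pos_of_pos hr (-(1 / 2))
  rw [rpowIntegral]
  linarith

theorem log_mul_integral_mul_rpow_neg_le (hr : 0 < r) :
    Real.log r * ∫ α in (0 : ℝ)..(1 / 2), α * r ^ (-α) ≤ rpowIntegral r := by
  have hc := continuous_rpow_neg hr
  have hc' := continuous_mul_rpow_neg hr
  have h := intervalIntegral.integral_eq_sub_of_hasDerivAt (a := 0) (b := 1 / 2)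
    (f := fun α => α * r ^ (-α)) (f' := fun α => r ^ (-α) - Real.log r * (α * r ^ (-α)))
    (fun α _ => ((hasDerivAt_id α).mul (hasDerivAt_rpow_neg hr α)).congr_deriv (by
      simp only [id]; ring))
    ((hc.sub (hc'.const_mul _)).intervalIntegrable _ _)
  rw [intervalIntegral.integral_sub (hc.intervalIntegrable _ _)
    ((hc'.const_mul _).intervalIntegrable _ _), intervalIntegral.integral_const_mul] at h
  have := Real.rpow_pos_of_pos hr (-(1 / 2))
  rw [rpowIntegral]
  linarith

theorem integral_mul_rpow_neg_le (hr : 0 < r) :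
    ∫ α in (0 : ℝ)..(1 / 2), α * r ^ (-α) ≤ 1 / 2 * rpowIntegral r := by
  rw [rpowIntegral, ← intervalIntegral.integral_const_mul]
  refine intervalIntegral.integral_mono_on (by norm_num)
    ((continuous_mul_rpow_neg hr).intervalIntegrable _ _)
    (((continuous_rpow_neg hr).const_mul _).intervalIntegrable _ _) fun α hα => ?_
  have := Real.rpow_pos_of_pos hr (-α)
  gcongr
  exact hα.2

theorem inv_le_two_mul_rpowIntegral (hr : 1 ≤ r) : r⁻¹ ≤ 2 * rpowIntegral r := by
  have hr0 : 0 < r := one_pos.trans_le hr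
  have h : ∫ _ in (0 : ℝ)..(1 / 2), r⁻¹ ≤ rpowIntegral r :=
    intervalIntegral.integral_mono_on (by norm_num) (by simp)
      ((continuous_rpow_neg hr0).intervalIntegrable _ _) fun α hα => by
        rw [← Real.rpow_neg_one]
        exact Real.rpow_le_rpow_of_exponent_le hr (by linarith [hα.2])
  rw [intervalIntegral.integral_const, smul_eq_mul] at h
  linarith

theorem norm_cpowIntegral_le (w : ℂ) : ‖cpowIntegral w‖ ≤ rpowIntegral ‖w‖ := by
  refine (intervalIntegral.norm_integral_le_integral_norm (by norm_num)).trans_eq ?_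
  simp_rw [← Complex.ofReal_neg, Complex.norm_cpow_real]
  rfl

theorem re_cpow_neg (hw : w ≠ 0) (α : ℝ) :
    (w ^ (-(α : ℂ))).re = ‖w‖ ^ (-α) * Real.cos (α * w.arg) := by
  rw [Complex.cpow_def_of_ne_zero hw, Complex.exp_re, Real.rpow_def_of_pos (norm_pos_iff.2 hw)]
  simp [Complex.log_re, Complex.log_im, mul_comm]

theorem rpowIntegral_sub_le_re_cpowIntegral (hw : 0 < w.re) :
    rpowIntegral ‖w‖ - ∫ α in (0 : ℝ)..(1 / 2), α * ‖w‖ ^ (-α) ≤ (cpowIntegral w).re := by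
  have hw0 : w ≠ 0 := fun h => by simp [h] at hw
  have hc := continuous_rpow_neg (norm_pos_iff.2 hw0)
  have hc' := continuous_mul_rpow_neg (norm_pos_iff.2 hw0)
  have hcpow : Continuous fun α : ℝ => w ^ (-(α : ℂ)) :=
    Complex.continuous_ofReal.neg.const_cpow (Or.inl hw0)
  have hre : (cpowIntegral w).re = ∫ α in (0 : ℝ)..(1 / 2), (w ^ (-(α : ℂ))).re :=
    (Complex.reCLM.intervalIntegral_comp_comm (hcpow.intervalIntegrable _ _)).symm
  have harg : w.arg ^ 2 ≤ 4 := by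
    have h := Complex.abs_arg_le_pi_div_two_iff.2 hw.le
    rw [← sq_abs]
    nlinarith [abs_nonneg w.arg, Real.pi_le_four]
  rw [hre, rpowIntegral, ← intervalIntegral.integral_sub (hc.intervalIntegrable _ _)
    (hc'.intervalIntegrable _ _)]
  refine intervalIntegral.integral_mono_on (by norm_num)
    ((hc.sub hc').intervalIntegrable _ _)
    ((Complex.continuous_re.comp hcpow).intervalIntegrable _ _) fun α hα => ?_
  have hcos : 1 - α ≤ Real.cos (α * w.arg) := by
    refine le_trans ?_ (Real.one_sub_sq_div_two_le_cos (x := α * w.arg))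
    nlinarith [hα.1, hα.2, mul_le_mul_of_nonneg_left harg (sq_nonneg α)]
  rw [re_cpow_neg hw0]
  calc ‖w‖ ^ (-α) - α * ‖w‖ ^ (-α) = ‖w‖ ^ (-α) * (1 - α) := by ring
    _ ≤ _ := by gcongr

theorem rpowIntegral_le_two_mul_re_cpowIntegral (hw : 0 < w.re) :
    rpowIntegral ‖w‖ ≤ 2 * (cpowIntegral w).re := by
  have hw0 : 0 < ‖w‖ := norm_pos_iff.2 fun h => by simp [h] at hw
  linarith [rpowIntegral_sub_le_re_cpowIntegral hw, integral_mul_rpow_neg_le hw0]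

theorem re_cpowIntegral_pos (hw : 0 < w.re) : 0 < (cpowIntegral w).re := by
  have hw0 : 0 < ‖w‖ := norm_pos_iff.2 fun h => by simp [h] at hw
  linarith [rpowIntegral_le_two_mul_re_cpowIntegral hw, rpowIntegral_pos hw0]

/-- A set of complex numbers that approaches the imaginary axis only at `0`, and there tangentially
to the positive half-line: its points with small real part are almost positive. For a Fourier
multiplier with values in such a set, `t ‖S e ^ (-tS)‖` is asymptotically at most `1 / e`. -/
def AlmostPositiveNearZero (s : Set ℂ) : Prop :=
  ∀ ε > 0, ∃ c > 0, ∀ z ∈ s, c ≤ z.re ∨ ‖z‖ ≤ (1 + ε) * z.re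

theorem almostPositiveNearZero_image_cpowIntegral :
    AlmostPositiveNearZero (cpowIntegral '' {w | 0 < w.re ∧ 1 ≤ ‖w‖}) := by
  refine fun ε hε => ⟨(4 * Real.exp (1 + 1 / ε))⁻¹, by positivity, ?_⟩
  rintro _ ⟨w, ⟨hw, hw1⟩, rfl⟩
  have hw0 : 0 < ‖w‖ := one_pos.trans_le hw1
  rcases le_total ‖w‖ (Real.exp (1 + 1 / ε)) with hR | hR
  · left
    have h₁ := inv_le_two_mul_rpowIntegral hw1
    have h₂ := inv_anti₀ hw0 hR
    rw [mul_inv]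
    linarith [rpowIntegral_le_two_mul_re_cpowIntegral hw]
  · right
    set L := Real.log ‖w‖
    have hL : 1 + 1 / ε ≤ L := (Real.le_log_iff_exp_le hw0).2 hR
    have hL0 : 0 < L := lt_of_lt_of_le (by positivity) hL
    have hεL : L ≤ (1 + ε) * (L - 1) := by
      have := mul_le_mul_of_nonneg_left hL hε.le
      rw [mul_add, mul_one_div_cancel hε.ne'] at this
      linarith
    have hre : (L - 1) * rpowIntegral ‖w‖ ≤ L * (cpowIntegral w).re := by
      have := mul_le_mul_of_nonneg_left (rpowIntegral_sub_le_re_cpowIntegral hw) hL0.le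
      linarith [log_mul_integral_mul_rpow_neg_le hw0]
    refine le_of_mul_le_mul_left ?_ hL0
    calc L * ‖cpowIntegral w‖ ≤ L * rpowIntegral ‖w‖ := by gcongr; exact norm_cpowIntegral_le w
      _ ≤ (1 + ε) * (L - 1) * rpowIntegral ‖w‖ :=
        mul_le_mul_of_nonneg_right hεL (rpowIntegral_pos hw0).le
      _ = (1 + ε) * ((L - 1) * rpowIntegral ‖w‖) := mul_assoc _ _ _
      _ ≤ (1 + ε) * (L * (cpowIntegral w).re) := by gcongr
      _ = L * ((1 + ε) * (cpowIntegral w).re) := by ring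

theorem mul_exp_neg_le (x : ℝ) : x * Real.exp (-x) ≤ 1 / Real.exp 1 := by
  rw [Real.exp_neg, ← div_eq_mul_inv, div_le_div_iff₀ (Real.exp_pos _) (Real.exp_pos _), one_mul]
  have := Real.add_one_le_exp (x - 1)
  rwa [sub_add_cancel, Real.exp_sub, le_div_iff₀ (Real.exp_pos _)] at this

theorem AlmostPositiveNearZero.mono {s t : Set ℂ} (ht : AlmostPositiveNearZero t) (h : s ⊆ t) :
    AlmostPositiveNearZero s := fun ε hε =>
  (ht ε hε).imp fun _ hc => ⟨hc.1, fun z hz => hc.2 z (h hz)⟩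

theorem AlmostPositiveNearZero.re_nonneg {s : Set ℂ} (hs : AlmostPositiveNearZero s) {z : ℂ}
    (hz : z ∈ s) : 0 ≤ z.re := by
  obtain ⟨c, hc, h⟩ := hs 1 one_pos
  rcases h z hz with hcz | hzre
  · exact hc.le.trans hcz
  · linarith [norm_nonneg z]

/-- Where `Re z` is small, `z` is almost positive and `t ‖z‖ e ^ (-t Re z)` is close to a value of
`x e ^ (-x)`, whose maximum is `1 / e`. -/
theorem eventually_mul_norm_mul_exp_le {s : Set ℂ} {K : ℝ} (hK : ∀ z ∈ s, ‖z‖ ≤ K)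
    (hs : AlmostPositiveNearZero s) {ε : ℝ} (hε : 0 < ε) :
    ∀ᶠ t : ℝ in atTop, ∀ z ∈ s, t * ‖z‖ * Real.exp (-(t * z.re)) ≤ 1 / Real.exp 1 + ε := by
  obtain ⟨c, hc, hsc⟩ := hs ε hε
  have hlim : Tendsto (fun t : ℝ => K * (t * Real.exp (-(c * t)))) atTop (𝓝 0) := by
    simpa using (tendsto_rpow_mul_exp_neg_mul_atTop_nhds_zero 1 c hc).const_mul K
  have hpos : 0 < 1 / Real.exp 1 + ε := by positivity
  filter_upwards [hlim.eventually (ge_mem_nhds hpos), eventually_ge_atTop 0] with t ht ht0 z hz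
  rcases hsc z hz with hcz | hzre
  · calc t * ‖z‖ * Real.exp (-(t * z.re)) ≤ t * K * Real.exp (-(t * c)) := by
          have := (norm_nonneg z).trans (hK z hz)
          gcongr
          exact hK z hz
      _ = K * (t * Real.exp (-(c * t))) := by ring_nf
      _ ≤ _ := ht
  · calc t * ‖z‖ * Real.exp (-(t * z.re))
        ≤ t * ((1 + ε) * z.re) * Real.exp (-(t * z.re)) := by gcongr
      _ = (1 + ε) * (t * z.re * Real.exp (-(t * z.re))) := by ring
      _ ≤ (1 + ε) * (1 / Real.exp 1) := by gcongr; exact mul_exp_neg_le _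
      _ ≤ 1 / Real.exp 1 + ε * 1 := by
          rw [add_mul, one_mul]
          gcongr
          exact (div_le_one (Real.exp_pos 1)).2 (Real.one_le_exp zero_le_one)
      _ = 1 / Real.exp 1 + ε := by rw [mul_one]

end Symbol

section VolterraMultiplier

/-- The point `1 + 2πiξ` at which the symbol of `L^α` at the frequency `ξ` is evaluated. -/
noncomputable def linePoint (ξ : ℝ) : ℂ := 1 + 2 * Real.pi * ξ * Complex.I

theorem linePoint_re (ξ : ℝ) : (linePoint ξ).re = 1 := by simp [linePoint]

theorem linePoint_re_pos (ξ : ℝ) : 0 < (linePoint ξ).re := by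
  rw [linePoint_re]
  exact one_pos

theorem one_le_norm_linePoint (ξ : ℝ) : 1 ≤ ‖linePoint ξ‖ :=
  (linePoint_re ξ).ge.trans (Complex.re_le_norm _)

/-- The causal Fourier multiplier with convolution kernel `ker α`, which is the fractional
integration `(1 + d/dx) ^ (-α)` on the whole line. It is `0` for `α ≤ 0`, as `frac α` is. -/
noncomputable def volterraMultiplier (α : ℝ) : causalMultipliers :=
  if hα : 0 < α then ⟨fourierSymbol (integrable_ker hα).ofReal,
    fourierSymbol_mem_causalMultipliers _ fun x hx => by simp [ker, hx.not_gt]⟩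
  else 0

variable {α β : ℝ}

theorem coe_volterraMultiplier (hα : 0 < α) :
    (volterraMultiplier α : ℝ →ᵇ ℂ) = fourierSymbol (integrable_ker hα).ofReal := by
  rw [volterraMultiplier, dif_pos hα]

theorem volterraMultiplier_apply (hα : 0 < α) (ξ : ℝ) :
    (volterraMultiplier α : ℝ →ᵇ ℂ) ξ = linePoint ξ ^ (-(α : ℂ)) := by
  rw [coe_volterraMultiplier hα]
  exact fourier_ker hα ξ

theorem norm_volterraMultiplier_le (hα : 0 < α) : ‖volterraMultiplier α‖ ≤ 1 := by
  refine (BoundedContinuousFunction.norm_le (f := (volterraMultiplier α : ℝ →ᵇ ℂ))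
    zero_le_one).2 fun ξ => ?_
  rw [volterraMultiplier_apply hα, ← Complex.ofReal_neg, Complex.norm_cpow_real]
  exact Real.rpow_le_one_of_one_le_of_nonpos (one_le_norm_linePoint ξ) (neg_nonpos.2 hα.le)

theorem norm_volterraMultiplier_sub_le {δ : ℝ} (hδ : 0 < δ) (hα : δ ≤ α) (hβ : δ ≤ β) :
    ‖volterraMultiplier α - volterraMultiplier β‖ ≤ (1 / δ + Real.pi) * |α - β| := by
  refine (BoundedContinuousFunction.norm_le (f :=
    (volterraMultiplier α - volterraMultiplier β : ℝ →ᵇ ℂ)) (by positivity)).2 fun ξ => ?_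
  rw [BoundedContinuousFunction.sub_apply,
    volterraMultiplier_apply (hδ.trans_le hα), volterraMultiplier_apply (hδ.trans_le hβ)]
  exact norm_cpow_neg_sub_le (one_le_norm_linePoint ξ) hδ hα hβ

theorem continuousOn_volterraMultiplier : ContinuousOn volterraMultiplier (Set.Ioi 0) := by
  intro α (hα : 0 < α)
  refine ContinuousAt.continuousWithinAt (tendsto_iff_norm_sub_tendsto_zero.2 ?_)
  have hlim : Tendsto (fun β => (1 / (α / 2) + Real.pi) * |β - α|) (𝓝 α) (𝓝 0) :=
    (by fun_prop : Continuous _).tendsto' _ _ (by simp)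
  refine squeeze_zero' (Eventually.of_forall fun β => norm_nonneg _) ?_ hlim
  filter_upwards [lt_mem_nhds (half_lt_self hα)] with β hβ
  exact norm_volterraMultiplier_sub_le (half_pos hα) hβ.le (half_lt_self hα).le

theorem intervalIntegrable_volterraMultiplier :
    IntervalIntegrable volterraMultiplier volume 0 (1 / 2) := by
  have := secondCountableTopologyEither_of_left ℝ causalMultipliers
  rw [intervalIntegrable_iff_integrableOn_Ioc_of_le (by norm_num)]
  refine Integrable.of_bound ((continuousOn_volterraMultiplier.mono fun α hα =>
    hα.1).aestronglyMeasurable measurableSet_Ioc) 1 ?_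
  filter_upwards [ae_restrict_mem measurableSet_Ioc] with α hα
  exact norm_volterraMultiplier_le hα.1

theorem causalCompression_volterraMultiplier (α : ℝ) :
    causalCompression 0 1 (volterraMultiplier α) = frac α := by
  by_cases hα : 0 < α
  · ext1 f
    ext1
    have h := compression_fourierSymbol measurableSet_Icc measure_Icc_lt_top.ne
      (integrable_ker hα).ofReal f
    rw [← coe_volterraMultiplier hα] at h
    exact h.trans ((frac_ae hα f).trans (fracFun_ae α f)).symm
  · rw [volterraMultiplier, dif_neg hα, map_zero, frac, dif_neg hα]

/-- The causal Fourier multiplier `∫_0^{1/2} (1 + d/dx) ^ (-α) dα`, whose compression to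
`L²([0, 1])` is `-A`. -/
noncomputable def volterraIntegral : causalMultipliers :=
  ∫ α in (0 : ℝ)..(1 / 2), volterraMultiplier α

theorem volterraIntegral_apply (ξ : ℝ) :
    (volterraIntegral : ℝ →ᵇ ℂ) ξ = cpowIntegral (linePoint ξ) := by
  let ev : causalMultipliers →L[ℂ] ℂ :=
    (BoundedContinuousFunction.evalCLM ℂ ξ).comp causalMultipliers.toSubmodule.subtypeL
  calc ev volterraIntegral = ∫ α in (0 : ℝ)..(1 / 2), ev (volterraMultiplier α) :=
        (ev.intervalIntegral_comp_comm intervalIntegrable_volterraMultiplier).symm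
    _ = cpowIntegral (linePoint ξ) := by
        refine intervalIntegral.integral_congr_ae (ae_of_all _ fun α hα => ?_)
        rw [Set.uIoc_of_le (by norm_num)] at hα
        exact volterraMultiplier_apply hα.1 ξ

theorem intervalIntegrable_frac : IntervalIntegrable frac volume 0 (1 / 2) := by
  have h := intervalIntegrable_volterraMultiplier
  let Φ := (causalCompression 0 1).toContinuousLinearMap
  rw [← funext causalCompression_volterraMultiplier]
  exact ⟨Φ.integrable_comp h.1, Φ.integrable_comp h.2⟩

theorem causalCompression_volterraIntegral : causalCompression 0 1 volterraIntegral = -opA := by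
  have h := (causalCompression 0 1).toContinuousLinearMap.intervalIntegral_comp_comm
    intervalIntegrable_volterraMultiplier
  rw [opA, neg_neg, ← funext causalCompression_volterraMultiplier]
  exact h.symm

end VolterraMultiplier

section Asymptotics

theorem norm_exp_sub_one_le_of_re_nonpos {z : ℂ} (hz : z.re ≤ 0) : ‖Complex.exp z - 1‖ ≤ ‖z‖ := by
  have h := (convex_halfSpace_re_le 0).norm_image_sub_le_of_norm_deriv_le (f := Complex.exp)
    (C := 1) (x := 0) (y := z) (fun x _ => Complex.differentiableAt_exp) (fun x hx => by
      rw [Complex.deriv_exp, Complex.norm_exp]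
      exact Real.exp_le_one_iff.2 hx) (by simp) hz
  simpa using h

theorem norm_causalCompression_le_of_forall_le {a b C : ℝ} {m : causalMultipliers} (hC : 0 ≤ C)
    (hm : ∀ ξ, ‖(m : ℝ →ᵇ ℂ) ξ‖ ≤ C) : ‖causalCompression a b m‖ ≤ C :=
  (norm_causalCompression_le a b m).trans
    ((BoundedContinuousFunction.norm_le (f := (m : ℝ →ᵇ ℂ)) hC).2 hm)

variable {S : causalMultipliers} {ε : ℝ}

theorem eventually_mul_norm_causalCompression_mul_exp_le (a b : ℝ)
    (hS : AlmostPositiveNearZero (Set.range (S : ℝ →ᵇ ℂ))) (hε : 0 < ε) :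
    ∀ᶠ t : ℝ in atTop, t * ‖causalCompression a b S *
      NormedSpace.exp (-((t : ℂ) • causalCompression a b S))‖ ≤ 1 / Real.exp 1 + ε := by
  have hbound : ∀ z ∈ Set.range (S : ℝ →ᵇ ℂ), ‖z‖ ≤ ‖(S : ℝ →ᵇ ℂ)‖ :=
    Set.forall_mem_range.2 (S : ℝ →ᵇ ℂ).norm_coe_le_norm
  filter_upwards [eventually_mul_norm_mul_exp_le hbound hS hε, eventually_gt_atTop 0] with t ht ht0
  rw [← map_smul, ← map_neg, ← causalCompression_exp, ← map_mul, ← le_div_iff₀' ht0]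
  refine norm_causalCompression_le_of_forall_le (by positivity) fun ξ => ?_
  rw [le_div_iff₀' ht0]
  calc t * ‖(S * NormedSpace.exp (-((t : ℂ) • S)) : causalMultipliers).1 ξ‖
      = t * ‖(S : ℝ →ᵇ ℂ) ξ‖ * Real.exp (-(t * ((S : ℝ →ᵇ ℂ) ξ).re)) := by
        rw [MulMemClass.coe_mul, BoundedContinuousFunction.mul_apply, exp_causalMultiplier_apply,
          norm_mul, Complex.norm_exp, mul_assoc]
        simp
    _ ≤ 1 / Real.exp 1 + ε := ht _ (Set.mem_range_self ξ)

theorem eventually_mul_norm_exp_causalCompression_pow_sub_le (a b : ℝ)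
    (hS : AlmostPositiveNearZero (Set.range (S : ℝ →ᵇ ℂ))) (hε : 0 < ε) :
    ∀ᶠ n : ℕ in atTop, n * ‖NormedSpace.exp (-causalCompression a b S) ^ (n + 1) -
      NormedSpace.exp (-causalCompression a b S) ^ n‖ ≤ 1 / Real.exp 1 + ε := by
  have hbound : ∀ z ∈ Set.range (S : ℝ →ᵇ ℂ), ‖z‖ ≤ ‖(S : ℝ →ᵇ ℂ)‖ :=
    Set.forall_mem_range.2 (S : ℝ →ᵇ ℂ).norm_coe_le_norm
  filter_upwards [tendsto_natCast_atTop_atTop.eventually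
    (eventually_mul_norm_mul_exp_le hbound hS hε), eventually_gt_atTop 0] with n hn hn0
  have hn0' : (0 : ℝ) < n := Nat.cast_pos.2 hn0
  rw [← map_neg, ← causalCompression_exp, ← map_pow, ← map_pow, ← map_sub, ← le_div_iff₀' hn0']
  refine norm_causalCompression_le_of_forall_le (by positivity) fun ξ => ?_
  rw [le_div_iff₀' hn0']
  set z := (S : ℝ →ᵇ ℂ) ξ
  have hz0 : (-z).re ≤ 0 := neg_nonpos.2 (hS.re_nonneg (Set.mem_range_self ξ))
  calc n * ‖(NormedSpace.exp (-S) ^ (n + 1) - NormedSpace.exp (-S) ^ n : causalMultipliers).1 ξ‖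
      = n * ‖Complex.exp (-z) ^ n * (Complex.exp (-z) - 1)‖ := by
        have h : (NormedSpace.exp (-S) : causalMultipliers).1 ξ = Complex.exp (-z) :=
          exp_causalMultiplier_apply (-S) ξ
        rw [mul_sub, mul_one, ← pow_succ, ← h]
        rfl
    _ = n * ‖Complex.exp (-z) - 1‖ * Real.exp (-(n * z.re)) := by
        rw [← Complex.exp_nat_mul, norm_mul, Complex.norm_exp, mul_assoc, mul_comm (Real.exp _)]
        simp
    _ ≤ n * ‖z‖ * Real.exp (-(n * z.re)) := by
        gcongr
        simpa using norm_exp_sub_one_le_of_re_nonpos hz0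
    _ ≤ 1 / Real.exp 1 + ε := hn _ (Set.mem_range_self ξ)

theorem limsup_coe_le_of_forall_eventually_le {ι : Type*} {f : Filter ι} {u : ι → ℝ} {a : ℝ}
    (h : ∀ ε > 0, ∀ᶠ i in f, u i ≤ a + ε) :
    limsup (fun i => (u i : EReal)) f ≤ (a : EReal) := by
  refine EReal.le_of_forall_lt_iff_le.1 fun x hx => limsup_le_of_le (h := ?_)
  filter_upwards [h (x - a) (sub_pos.2 (EReal.coe_lt_coe_iff.1 hx))] with i hi
  exact EReal.coe_le_coe_iff.2 (by linarith)

theorem almostPositiveNearZero_range_volterraIntegral :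
    AlmostPositiveNearZero (Set.range (volterraIntegral : ℝ →ᵇ ℂ)) := by
  refine almostPositiveNearZero_image_cpowIntegral.mono ?_
  rintro _ ⟨ξ, rfl⟩
  exact ⟨linePoint ξ, ⟨linePoint_re_pos ξ, one_le_norm_linePoint ξ⟩,
    (volterraIntegral_apply ξ).symm⟩

theorem limsup_mul_norm_opA_mul_exp_le :
    limsup (fun t : ℝ => ((t * ‖opA * NormedSpace.exp ((t : ℂ) • opA)‖ : ℝ) : EReal)) atTop
      ≤ ((1 / Real.exp 1 : ℝ) : EReal) := by
  refine limsup_coe_le_of_forall_eventually_le fun ε hε => ?_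
  filter_upwards [eventually_mul_norm_causalCompression_mul_exp_le 0 1
    almostPositiveNearZero_range_volterraIntegral hε] with t ht
  rwa [causalCompression_volterraIntegral, smul_neg, neg_neg, neg_mul, norm_neg] at ht

theorem limsup_mul_norm_opT_pow_sub_le :
    limsup (fun n : ℕ => (((n : ℝ) * ‖opT ^ (n + 1) - opT ^ n‖ : ℝ) : EReal)) atTop
      ≤ ((1 / Real.exp 1 : ℝ) : EReal) := by
  refine limsup_coe_le_of_forall_eventually_le fun ε hε => ?_
  filter_upwards [eventually_mul_norm_exp_causalCompression_pow_sub_le 0 1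
    almostPositiveNearZero_range_volterraIntegral hε] with n hn
  rwa [causalCompression_volterraIntegral, neg_neg] at hn

end Asymptotics

section Spectrum

theorem spectrum_eq_singleton_of_tendsto_units_conj {𝔸 ι : Type*} [NormedRing 𝔸]
    [NormedAlgebra ℂ 𝔸] [CompleteSpace 𝔸] [Nontrivial 𝔸] {f : Filter ι} [f.NeBot] {u : ι → 𝔸ˣ}
    {x : 𝔸} {c : ℂ} (h : Tendsto (fun i => u i * x * ↑(u i)⁻¹) f (𝓝 (algebraMap ℂ 𝔸 c))) :
    spectrum ℂ x = {c} := by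
  refine (spectrum.nonempty x).subset_singleton_iff.1 fun k hk => ?_
  have hle (i : ι) : ‖k - c‖ ≤ ‖u i * x * ↑(u i)⁻¹ - algebraMap ℂ 𝔸 c‖ * ‖(1 : 𝔸)‖ := by
    refine spectrum.norm_le_norm_mul_of_mem ?_
    rw [← spectrum.sub_singleton_eq, spectrum.units_conjugate]
    exact Set.sub_mem_sub hk rfl
  have hlim := (tendsto_iff_norm_sub_tendsto_zero.1 h).mul_const ‖(1 : 𝔸)‖
  rw [zero_mul] at hlim
  exact sub_eq_zero.1 (norm_le_zero_iff.1 (ge_of_tendsto' hlim hle))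

variable {a b l : ℝ}

/-- The function `x ↦ exp (-(l * x))` on `[a, b]`, extended to a bounded continuous function by
constants. -/
noncomputable def expWeight (a b l : ℝ) : ℝ →ᵇ ℂ :=
  BoundedContinuousFunction.ofNormedAddCommGroup
    (fun x => ((Real.exp (-(l * max a (min b x))) : ℝ) : ℂ)) (by fun_prop)
    (Real.exp (|l| * max |a| |b|)) fun x => by
      rw [Complex.norm_real, Real.norm_of_nonneg (Real.exp_pos _).le, Real.exp_le_exp]
      refine (neg_le_abs _).trans ?_
      rw [abs_mul]
      gcongr
      grind

theorem expWeight_apply {x : ℝ} (hx : x ∈ Set.Icc a b) :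
    expWeight a b l x = Real.exp (-(l * x)) := by
  simp [expWeight, hx.1, hx.2]

theorem expWeight_mul_expWeight_neg (a b l : ℝ) : expWeight a b l * expWeight a b (-l) = 1 := by
  ext x
  simp [expWeight, ← Complex.exp_add]

/-- Multiplication by `exp (-(l * x))` on `L²([a, b])`. Conjugation by it multiplies a convolution
kernel by `exp (-(l * x))`. -/
noncomputable def expWeightUnit (a b l : ℝ) : (Lp ℂ 2 (volume.restrict (Set.Icc a b)) →L[ℂ]
    Lp ℂ 2 (volume.restrict (Set.Icc a b)))ˣ where
  val := mulOp 2 _ (expWeight a b l)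
  inv := mulOp 2 _ (expWeight a b (-l))
  val_inv := by rw [← map_mul, expWeight_mul_expWeight_neg, map_one]
  inv_val := by rw [← map_mul, mul_comm, expWeight_mul_expWeight_neg, map_one]

theorem expWeightUnit_conj_compression {k : ℝ → ℂ} (hk : Integrable k)
    (hkl : Integrable fun s => k s * Real.exp (-(l * s))) :
    expWeightUnit a b l * compression (Set.Icc a b) (fourierSymbol hk) * ↑(expWeightUnit a b l)⁻¹
      = compression (Set.Icc a b) (fourierSymbol hkl) := by
  ext f
  set g := mulOp 2 (volume.restrict (Set.Icc a b)) (expWeight a b (-l)) f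
  filter_upwards [coeFn_mulOp (expWeight a b l) (compression (Set.Icc a b) (fourierSymbol hk) g),
    compression_fourierSymbol measurableSet_Icc measure_Icc_lt_top.ne hk g,
    compression_fourierSymbol measurableSet_Icc measure_Icc_lt_top.ne hkl f,
    ae_restrict_mem measurableSet_Icc] with x h₁ h₂ h₃ hx
  rw [h₂] at h₁
  refine h₁.trans (Eq.trans ?_ h₃.symm)
  rw [← integral_const_mul]
  refine integral_congr_ae ?_
  filter_upwards [coeFn_mulOp (expWeight a b (-l)) f, ae_restrict_mem measurableSet_Icc]
    with y h hy
  have hexp : Real.exp (-(l * (x - y))) = Real.exp (-(l * x)) * Real.exp (-(-l * y)) := by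
    rw [← Real.exp_add]
    ring_nf
  rw [h, expWeight_apply hx, expWeight_apply hy, hexp]
  push_cast
  ring

theorem ker_nonneg {α : ℝ} (hα : 0 < α) (s : ℝ) : 0 ≤ ker α s := by
  have := Real.Gamma_pos_of_pos hα
  unfold ker
  split_ifs <;> positivity

theorem integrable_ker_mul_exp {α : ℝ} (hα : 0 < α) (hl : 0 ≤ l) :
    Integrable fun s => ker α s * Real.exp (-(l * s)) := by
  refine not_imp_comm.1 integral_undef ?_
  rw [integral_ker_mul_exp hα hl]
  positivity

theorem norm_expWeightUnit_conj_frac_le {α : ℝ} (hα : 0 < α) (hl : 0 ≤ l) :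
    ‖expWeightUnit 0 1 l * frac α * ↑(expWeightUnit 0 1 l)⁻¹‖ ≤ (1 + l) ^ (-α) := by
  have hk : Integrable fun s => (ker α s : ℂ) * Real.exp (-(l * s)) := by
    exact_mod_cast (integrable_ker_mul_exp hα hl).ofReal (𝕜 := ℂ)
  have hfrac : compression (Set.Icc 0 1) (fourierSymbol (integrable_ker hα).ofReal) = frac α := by
    rw [← causalCompression_volterraMultiplier, ← coe_volterraMultiplier hα]
    rfl
  rw [← hfrac, expWeightUnit_conj_compression _ hk]
  refine (norm_compression_le _).trans ((norm_fourierSymbol_le hk).trans_eq ?_)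
  rw [← integral_ker_mul_exp hα hl]
  refine integral_congr_ae (ae_of_all _ fun s => ?_)
  simp only [← Complex.ofReal_mul, Complex.norm_real]
  exact Real.norm_of_nonneg (mul_nonneg (ker_nonneg hα s) (Real.exp_pos _).le)

theorem norm_expWeightUnit_conj_opA_le (hl : 0 ≤ l) :
    ‖expWeightUnit 0 1 l * opA * ↑(expWeightUnit 0 1 l)⁻¹‖ ≤ rpowIntegral (1 + l) := by
  let conj : (L2 →L[ℂ] L2) →L[ℂ] (L2 →L[ℂ] L2) :=
    ContinuousLinearMap.mulLeftRight ℂ _ (expWeightUnit 0 1 l : L2 →L[ℂ] L2)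
      (↑(expWeightUnit 0 1 l)⁻¹ : L2 →L[ℂ] L2)
  calc ‖conj opA‖ = ‖∫ α in (0 : ℝ)..(1 / 2), conj (frac α)‖ := by
        rw [opA, map_neg, norm_neg, conj.intervalIntegral_comp_comm intervalIntegrable_frac]
    _ ≤ rpowIntegral (1 + l) :=
        intervalIntegral.norm_integral_le_of_norm_le (by norm_num)
          (ae_of_all _ fun α hα => norm_expWeightUnit_conj_frac_le hα.1 hl)
          ((continuous_rpow_neg (by positivity)).intervalIntegrable _ _)

theorem tendsto_rpowIntegral_atTop : Tendsto rpowIntegral atTop (𝓝 0) := by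
  refine squeeze_zero' ?_ ?_ Real.tendsto_log_atTop.inv_tendsto_atTop
  · filter_upwards [eventually_gt_atTop 0] with r hr using (rpowIntegral_pos hr).le
  · filter_upwards [eventually_gt_atTop 1] with r hr
    rw [Pi.inv_apply, le_inv_comm₀ (rpowIntegral_pos (zero_lt_one.trans hr)) (Real.log_pos hr),
      ← one_div, le_div_iff₀ (rpowIntegral_pos (zero_lt_one.trans hr))]
    exact log_mul_rpowIntegral_le_one (zero_lt_one.trans hr)

theorem tendsto_expWeightUnit_conj_opA :
    Tendsto (fun l => expWeightUnit 0 1 l * opA * ↑(expWeightUnit 0 1 l)⁻¹) atTop (𝓝 0) :=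
  squeeze_zero_norm' ((eventually_ge_atTop 0).mono fun _ hl => norm_expWeightUnit_conj_opA_le hl)
    (tendsto_rpowIntegral_atTop.comp (tendsto_atTop_add_const_left _ 1 tendsto_id))

theorem tendsto_expWeightUnit_conj_opT :
    Tendsto (fun l => expWeightUnit 0 1 l * opT * ↑(expWeightUnit 0 1 l)⁻¹) atTop (𝓝 1) := by
  let := NormedAlgebra.restrictScalars ℚ ℂ (L2 →L[ℂ] L2)
  simp_rw [opT, ← NormedSpace.exp_units_conj]
  exact (NormedSpace.exp_continuous.tendsto' 0 1 NormedSpace.exp_zero).comp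
    tendsto_expWeightUnit_conj_opA

instance : Nontrivial L2 :=
  nontrivial_Lp_restrict (by simp) measure_Icc_lt_top.ne

theorem spectrum_opA : spectrum ℂ opA = {0} :=
  spectrum_eq_singleton_of_tendsto_units_conj (f := atTop) (u := expWeightUnit 0 1)
    (by simpa using tendsto_expWeightUnit_conj_opA)

theorem spectrum_opT : spectrum ℂ opT = {1} :=
  spectrum_eq_singleton_of_tendsto_units_conj (f := atTop) (u := expWeightUnit 0 1)
    (by simpa using tendsto_expWeightUnit_conj_opT)

end Spectrum

section Positivity

theorem re_inner_mulOp_pos {X : Type*} [TopologicalSpace X] [MeasurableSpace X] [BorelSpace X]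
    {μ : Measure X} {m : X →ᵇ ℂ} (hm : ∀ x, 0 < (m x).re) {f : Lp ℂ 2 μ} (hf : f ≠ 0) :
    0 < (inner ℂ f (mulOp 2 μ m f)).re := by
  have hae : (fun x => (inner ℂ (f x) (mulOp 2 μ m f x)).re) =ᵐ[μ]
      fun x => (m x).re * ‖f x‖ ^ 2 := by
    filter_upwards [coeFn_mulOp m f] with x hx
    rw [hx, RCLike.inner_apply, mul_assoc, Complex.mul_conj', ← Complex.ofReal_pow,
      Complex.re_mul_ofReal]
  have hint : Integrable (fun x => (inner ℂ (f x) (mulOp 2 μ m f x)).re) μ :=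
    Integrable.re (𝕜 := ℂ) (L2.integrable_inner f (mulOp 2 μ m f))
  have hre : (inner ℂ f (mulOp 2 μ m f)).re = ∫ x, (m x).re * ‖f x‖ ^ 2 ∂μ := by
    rw [L2.inner_def, ← integral_congr_ae hae]
    exact (integral_re (𝕜 := ℂ) (L2.integrable_inner f (mulOp 2 μ m f))).symm
  rw [hre, integral_pos_iff_support_of_nonneg
    (fun x => mul_nonneg (hm x).le (sq_nonneg _)) (hint.congr hae)]
  have hsupp : Function.support (fun x => (m x).re * ‖f x‖ ^ 2) = {x | ¬ f x = 0} := by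
    ext x
    simp [(hm x).ne']
  rw [hsupp, pos_iff_ne_zero]
  exact fun h => hf ((Lp.eq_zero_iff_ae_eq_zero).2 h)

theorem re_inner_compression_pos {E : Type*} [NormedAddCommGroup E] [InnerProductSpace ℝ E]
    [FiniteDimensional ℝ E] [MeasurableSpace E] [BorelSpace E] {s : Set E} (hs : MeasurableSet s)
    {m : E →ᵇ ℂ}
    (hm : ∀ ξ, 0 < (m ξ).re) {f : Lp ℂ 2 (volume.restrict s)} (hf : f ≠ 0) :
    0 < (inner ℂ f (compression s m f)).re := by
  set g := extendL2 volume s f with hg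
  have hg0 : 𝓕 g ≠ 0 := by
    rw [← norm_ne_zero_iff, Lp.norm_fourier_eq, norm_ne_zero_iff]
    intro h
    rw [← restrictL2_extendL2 hs f, ← hg, h, map_zero] at hf
    exact hf rfl
  calc 0 < (inner ℂ (𝓕 g) (mulOp 2 volume m (𝓕 g))).re := re_inner_mulOp_pos hm hg0
    _ = (inner ℂ f (compression s m f)).re := by
      rw [← fourier_fourierMultiplier, Lp.inner_fourier_eq, compression_apply, hg, extendL2,
        ContinuousLinearMap.adjoint_inner_left]

theorem causalCompression_ne_zero {a b : ℝ} (hab : a < b) {m : causalMultipliers}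
    (hm : ∀ ξ, 0 < ((m : ℝ →ᵇ ℂ) ξ).re) : causalCompression a b m ≠ 0 := by
  intro h
  have : Nontrivial (Lp ℂ 2 (volume.restrict (Set.Icc a b))) :=
    nontrivial_Lp_restrict (by simpa using hab) measure_Icc_lt_top.ne
  obtain ⟨f, hf⟩ := exists_ne (0 : Lp ℂ 2 (volume.restrict (Set.Icc a b)))
  have hpos := re_inner_compression_pos measurableSet_Icc hm hf
  change 0 < (inner ℂ f (causalCompression a b m f)).re at hpos
  simp [h] at hpos

theorem re_volterraIntegral_pos (ξ : ℝ) : 0 < ((volterraIntegral : ℝ →ᵇ ℂ) ξ).re := by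
  rw [volterraIntegral_apply]
  exact re_cpowIntegral_pos (linePoint_re_pos ξ)

theorem opA_ne_zero : opA ≠ 0 := by
  have h := causalCompression_ne_zero one_pos re_volterraIntegral_pos
  rwa [causalCompression_volterraIntegral, neg_ne_zero] at h

theorem opT_ne_one : opT ≠ 1 := by
  have hT : causalCompression 0 1 (1 - NormedSpace.exp (-volterraIntegral)) = 1 - opT := by
    rw [map_sub, map_one, causalCompression_exp, map_neg, causalCompression_volterraIntegral,
      neg_neg, opT]
  refine fun h => causalCompression_ne_zero one_pos (fun ξ => ?_) (hT.trans (by rw [h, sub_self]))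
  have hexp : ‖Complex.exp (-(volterraIntegral : ℝ →ᵇ ℂ) ξ)‖ < 1 := by
    rw [Complex.norm_exp, Real.exp_lt_one_iff, Complex.neg_re, neg_lt_zero]
    exact re_volterraIntegral_pos ξ
  have happly : ((1 - NormedSpace.exp (-volterraIntegral) : causalMultipliers) : ℝ →ᵇ ℂ) ξ =
      1 - Complex.exp (-(volterraIntegral : ℝ →ᵇ ℂ) ξ) :=
    congrArg (1 - ·) (exp_causalMultiplier_apply (-volterraIntegral) ξ)
  rw [happly, Complex.sub_re, Complex.one_re, sub_pos]
  exact (Complex.re_le_norm _).trans_lt hexp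

end Positivity

end ModVolterra

theorem theorem2p3 :
    -- the operator integral `∫_0^{1/2} L^α dα` converges absolutely
    IntervalIntegrable ModVolterra.frac volume (0 : ℝ) (1 / 2) ∧
    -- continuous time: `A = -∫_0^{1/2} L^α dα`
    (ModVolterra.opA ≠ 0 ∧ spectrum ℂ ModVolterra.opA = {0} ∧
      limsup (fun t : ℝ =>
        ((t * ‖ModVolterra.opA * NormedSpace.exp ((t : ℂ) • ModVolterra.opA)‖ : ℝ) : EReal)) atTop
        ≤ ((1 / Real.exp 1 : ℝ) : EReal)) ∧
    -- discrete time: `T = e^A`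
    (ModVolterra.opT ≠ 1 ∧ spectrum ℂ ModVolterra.opT = {1} ∧
      limsup (fun n : ℕ =>
        (((n : ℝ) * ‖ModVolterra.opT ^ (n + 1) - ModVolterra.opT ^ n‖ : ℝ) : EReal)) atTop
        ≤ ((1 / Real.exp 1 : ℝ) : EReal)) ∧
    -- sharpness: `1/e` cannot be replaced by a larger constant, even on Hilbert spaces
    (∀ C : ℝ, 1 / Real.exp 1 < C →
      ¬ (∀ (H : Type) [NormedAddCommGroup H] [InnerProductSpace ℂ H] [CompleteSpace H]
          (A : H →L[ℂ] H), spectrum ℂ A = {0} →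
          liminf (fun t : ℝ => ((t * ‖A * NormedSpace.exp ((t : ℂ) • A)‖ : ℝ) : EReal)) atTop
            < (C : EReal) → A = 0) ∧
      ¬ (∀ (H : Type) [NormedAddCommGroup H] [InnerProductSpace ℂ H] [CompleteSpace H]
          (T : H →L[ℂ] H), spectrum ℂ T = {1} →
          liminf (fun n : ℕ => (((n : ℝ) * ‖T ^ (n + 1) - T ^ n‖ : ℝ) : EReal)) atTop
            < (C : EReal) → T = 1)) := by
  have hA := ModVolterra.limsup_mul_norm_opA_mul_exp_le
  have hT := ModVolterra.limsup_mul_norm_opT_pow_sub_le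
  refine ⟨ModVolterra.intervalIntegrable_frac,
    ⟨ModVolterra.opA_ne_zero, ModVolterra.spectrum_opA, hA⟩,
    ⟨ModVolterra.opT_ne_one, ModVolterra.spectrum_opT, hT⟩, fun C hC => ⟨fun h => ?_, fun h => ?_⟩⟩
  · exact ModVolterra.opA_ne_zero (h _ _ ModVolterra.spectrum_opA
      (((liminf_le_limsup).trans hA).trans_lt (EReal.coe_lt_coe_iff.2 hC)))
  · exact ModVolterra.opT_ne_one (h _ _ ModVolterra.spectrum_opT
      (((liminf_le_limsup).trans hT).trans_lt (EReal.coe_lt_coe_iff.2 hC)))
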